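/- Let $\ell\ge 0$ and $n\ge 1$ be integers and let $\mathfrak X=(X,\{R_i\}_{i=0}^{\ell})$ be a commutative association scheme of class $\ell$ on a finite set $X$. That is, the nonempty relations $R_0,\dots,R_\ell$ partition $X\times X$; their $0/1$ adjacency matrices $A_0,\dots,A_\ell\in M_X(\mathbb C)$ commute; the identity matrix is one of them; each $A_i^{T}$ is one of them; and each product $A_iA_j$ is a linear combination of them. Let $\mathcal D=\{\alpha\in\mathbb N^\ell : |\alpha|\le n\}$, where $\mathbb N=\{0,1,2,\dots\}$ and $|\alpha|=\alpha_1+\cdots+\alpha_\ell$. The extension (symmetrization, or generalized Hamming scheme) $\mathcal S^n(\mathfrak X)$ is $X^n$ with the relations $R_\alpha$ $(\alpha\in\mathcal D)$ given by $$(x,y)\in R_\alpha \iff |\{t : (x_t,y_t)\in R_i\}|=\alpha_i \text{ for } i=1,\dots,\ell .$$ Let $\epsilon_1,\dots,\epsilon_\ell$ be the unit vectors of $\mathbb N^\ell$, and let $\le$ be the graded lexicographic order on $\mathbb N^\ell$: $\alpha\le\beta$ if $|\alpha|<|\beta|$, or if $|\alpha|=|\beta|$ and either $\alpha=\beta$ or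 the leftmost nonzero entry of $\alpha-\beta\in\mathbb Z^\ell$ is negative. The multidegree of a nonzero polynomial is the largest exponent, with respect to $\le$, of a monomial occurring in it. A commutative association scheme on a finite set $Y$ is called $\ell$-variate $P$-polynomial on $\mathcal D\subset\mathbb N^\ell$ with respect to $\le$ if $\epsilon_1,\dots,\epsilon_\ell\in\mathcal D$ and: (i) if $\alpha\in\mathcal D$ and $\beta\in\mathbb N^\ell$ is entrywise at most $\alpha$, then $\beta\in\mathcal D$; (ii) its adjacency matrices can be labelled bijectively as $\{A_\alpha\}_{\alpha\in\mathcal D}$ so that for each $\alpha\in\mathcal D$ one has $A_\alpha=v_\alpha(A_{\epsilon_1},\dots,A_{\epsilon_\ell})$ for some nonzero $v_\alpha\in\mathbb C[x_1,\dots,x_\ell]$ of multidegree $\alpha$ all of whose monomials have exponents in $\mathcal D$; (iii) for this labelling, for each $i$ and each $\alpha\in\mathcal D$, the product $A_{\epsilon_i}A_{\epsilon_1}^{\alpha_1}\cdots A_{\epsilon_\ell}^{\alpha_\ell}$ is a linear combination of the matrices $A_{\epsilon_1}^{\beta_1}\cdots A_{\epsilon_\ell}^{\beta_\ell}$ with $\beta\in\mathcal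 D$ and $\beta\le\alpha+\epsilon_i$. It is called $\ell$-variate $Q$-polynomial on $\mathcal D$ with respect to $\le$ if $\epsilon_1,\dots,\epsilon_\ell\in\mathcal D$, (i) holds, and the primitive idempotents of its Bose–Mesner algebra (the span of the adjacency matrices, under the usual matrix product) can be labelled bijectively as $\{E_\alpha\}_{\alpha\in\mathcal D}$ so that, all products and powers now being entrywise (Hadamard), the following hold. For each $\alpha\in\mathcal D$ one has $|Y|E_\alpha=v^*_\alpha(|Y|E_{\epsilon_1},\dots,|Y|E_{\epsilon_\ell})$ for some nonzero polynomial $v^*_\alpha$ of multidegree $\alpha$ all of whose monomials have exponents in $\mathcal D$. For each $i$ and each $\alpha\in\mathcal D$, the matrix $E_{\epsilon_i}\circ E_{\epsilon_1}^{\circ\alpha_1}\circ\cdots\circ E_{\epsilon_\ell}^{\circ\alpha_\ell}$ is a linear combination of the matrices $E_{\epsilon_1}^{\circ\beta_1}\circ\cdots\circ E_{\epsilon_\ell}^{\circ\beta_\ell}$ with $\beta\in\mathcal D$ and $\beta\le\alpha+\epsilon_i$. **Theorem.** $\mathcal S^n(\mathfrak X)$ is a commutative association scheme, and it is both $\ell$-variate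 $P$-polynomial and $\ell$-variate $Q$-polynomial on $\mathcal D=\{\alpha\in\mathbb N^\ell : |\alpha|\le n\}$ with respect to the graded lexicographic order. -/

import Mathlib

open scoped Matrix

/-- The adjacency matrix `A_i` of the relation `R_i = {(x, y) | R x y = i}`. -/
noncomputable def adjMat {X I : Type*} (R : X → X → I) (i : I) : Matrix X X ℂ :=
  open Classical in Matrix.of fun x y => if R x y = i then 1 else 0

/-- `(X, R)` is a commutative association scheme with relations indexed by `I`.
The class of the scheme is `|I| - 1`. -/
structure IsCommAssocScheme {X I : Type*} [Fintype X] [DecidableEq X] [Fintype I]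
    (R : X → X → I) : Prop where
  surjective : Function.Surjective (Function.uncurry R)
  exists_one : ∃ i₀ : I, adjMat R i₀ = 1
  exists_transpose : ∀ i : I, ∃ i' : I, (adjMat R i)ᵀ = adjMat R i'
  exists_intersection : ∃ p : I → I → I → ℂ,
    ∀ i j : I, adjMat R i * adjMat R j = ∑ k : I, p i j k • adjMat R k
  comm : ∀ i j : I, adjMat R i * adjMat R j = adjMat R j * adjMat R i

/-- The Bose-Mesner algebra, as the linear span of the adjacency matrices. -/
noncomputable def boseMesner {X I : Type*} (R : X → X → I) : Submodule ℂ (Matrix X X ℂ) :=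
  Submodule.span ℂ (Set.range (adjMat R))

/-- `E` is a primitive idempotent of the Bose-Mesner algebra: a nonzero idempotent which is not the
sum of two nonzero orthogonal idempotents of that algebra. -/
structure IsPrimIdem {X I : Type*} [Fintype X] (R : X → X → I) (E : Matrix X X ℂ) : Prop where
  mem : E ∈ boseMesner R
  ne_zero : E ≠ 0
  idem : E * E = E
  primitive : ∀ F ∈ boseMesner R, ∀ G ∈ boseMesner R, F * F = F → G * G = G →
    F * G = 0 → G * F = 0 → E = F + G → F = 0 ∨ G = 0

/-- The exponent `ε_i`. -/
noncomputable def unitExp {ℓ : ℕ} (i : Fin ℓ) : Fin ℓ →₀ ℕ := Finsupp.single i 1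

/-- The monomial `M_1 ^ β_1 * ⋯ * M_ℓ ^ β_ℓ` for the usual matrix product, in this order. -/
noncomputable def matMonomial {X : Type*} [Fintype X] [DecidableEq X] {ℓ : ℕ}
    (M : Fin ℓ → Matrix X X ℂ) (β : Fin ℓ →₀ ℕ) : Matrix X X ℂ :=
  (List.ofFn fun i => M i ^ β i).prod

/-- The monomial in `M_1, …, M_ℓ` with exponent `β` for the entrywise (Hadamard) product. -/
noncomputable def hadMonomial {X : Type*} {ℓ : ℕ}
    (M : Fin ℓ → Matrix X X ℂ) (β : Fin ℓ →₀ ℕ) : Matrix X X ℂ :=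
  Matrix.of fun x y => ∏ i, M i x y ^ β i

/-- `v` is a nonzero polynomial of multidegree `α` with respect to the monomial order `m`, all of
whose monomials have exponents in `D`. -/
structure HasMultidegreeOn {ℓ : ℕ} (m : MonomialOrder (Fin ℓ)) (D : Set (Fin ℓ →₀ ℕ))
    (α : Fin ℓ →₀ ℕ) (v : MvPolynomial (Fin ℓ) ℂ) : Prop where
  ne_zero : v ≠ 0
  degree_eq : m.degree v = α
  support_subset : ∀ β ∈ v.support, β ∈ D

/-- `(X, R)` is an `ℓ`-variate `P`-polynomial association scheme on the domain `D` with respect to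
the monomial order `m`. The matrices `B α`, `α ∈ D`, are the relabelled adjacency matrices; the
values of `B` outside `D` play no role. -/
structure IsPPolynomial {X I : Type*} [Fintype X] [DecidableEq X] [Fintype I] {ℓ : ℕ}
    (m : MonomialOrder (Fin ℓ)) (D : Set (Fin ℓ →₀ ℕ)) (R : X → X → I) : Prop
    extends IsCommAssocScheme R where
  unit_mem : ∀ i, unitExp i ∈ D
  lower : ∀ α ∈ D, ∀ β : Fin ℓ →₀ ℕ, (∀ i, β i ≤ α i) → β ∈ D
  relabel : ∃ B : (Fin ℓ →₀ ℕ) → Matrix X X ℂ,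
    Set.BijOn B D (Set.range (adjMat R)) ∧
    (∀ α ∈ D, ∃ v : MvPolynomial (Fin ℓ) ℂ, HasMultidegreeOn m D α v ∧
      B α = ∑ β ∈ v.support, v.coeff β • matMonomial (fun i => B (unitExp i)) β) ∧
    (∀ i, ∀ α ∈ D,
      B (unitExp i) * matMonomial (fun j => B (unitExp j)) α ∈
        Submodule.span ℂ {M | ∃ β ∈ D, m.toSyn β ≤ m.toSyn (α + unitExp i) ∧
          M = matMonomial (fun j => B (unitExp j)) β})

/-- `(X, R)` is an `ℓ`-variate `Q`-polynomial association scheme on the domain `D` with respect to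
the monomial order `m`. The matrices `E α`, `α ∈ D`, are the relabelled primitive idempotents; the
values of `E` outside `D` play no role. -/
structure IsQPolynomial {X I : Type*} [Fintype X] [DecidableEq X] [Fintype I] {ℓ : ℕ}
    (m : MonomialOrder (Fin ℓ)) (D : Set (Fin ℓ →₀ ℕ)) (R : X → X → I) : Prop
    extends IsCommAssocScheme R where
  unit_mem : ∀ i, unitExp i ∈ D
  lower : ∀ α ∈ D, ∀ β : Fin ℓ →₀ ℕ, (∀ i, β i ≤ α i) → β ∈ D
  relabel : ∃ E : (Fin ℓ →₀ ℕ) → Matrix X X ℂ,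
    Set.BijOn E D {F | IsPrimIdem R F} ∧
    (∀ α ∈ D, ∃ v : MvPolynomial (Fin ℓ) ℂ, HasMultidegreeOn m D α v ∧
      (Fintype.card X : ℂ) • E α = ∑ β ∈ v.support,
        v.coeff β • hadMonomial (fun i => (Fintype.card X : ℂ) • E (unitExp i)) β) ∧
    (∀ i, ∀ α ∈ D,
      E (unitExp i) ⊙ hadMonomial (fun j => E (unitExp j)) α ∈
        Submodule.span ℂ {M | ∃ β ∈ D, m.toSyn β ≤ m.toSyn (α + unitExp i) ∧
          M = hadMonomial (fun j => E (unitExp j)) β})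

/-- The domain `{α ∈ ℕ^ℓ | |α| ≤ n}`. -/
def simplexDomain (ℓ n : ℕ) : Set (Fin ℓ →₀ ℕ) := {α | ∑ i, α i ≤ n}

theorem simplexDomain_finite (ℓ n : ℕ) : (simplexDomain ℓ n).Finite := by
  refine (Set.finite_Iic (Finsupp.equivFunOnFinite.symm fun _ : Fin ℓ => n)).subset ?_
  intro α hα i
  exact (Finset.single_le_sum (f := fun i => α i) (fun _ _ => Nat.zero_le _)
    (Finset.mem_univ i)).trans hα

noncomputable instance simplexDomainFintype (ℓ n : ℕ) : Fintype (simplexDomain ℓ n) :=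
  (simplexDomain_finite ℓ n).fintype

/-- `τ_i(x, y) = |{t | (x_t, y_t) ∈ R_i}|`. -/
def extensionCount {X : Type*} {ℓ : ℕ} (R : X → X → Fin (ℓ + 1)) {n : ℕ} (x y : Fin n → X)
    (i : Fin (ℓ + 1)) : ℕ :=
  (Finset.univ.filter fun t => R (x t) (y t) = i).card

/-- The tuple `(τ_1(x, y), …, τ_ℓ(x, y))`. -/
noncomputable def extensionTuple {X : Type*} {ℓ : ℕ} (R : X → X → Fin (ℓ + 1)) {n : ℕ}
    (x y : Fin n → X) : Fin ℓ →₀ ℕ :=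
  Finsupp.equivFunOnFinite.symm fun i => extensionCount R x y i.succ

theorem extensionTuple_mem {X : Type*} {ℓ : ℕ} (R : X → X → Fin (ℓ + 1)) {n : ℕ}
    (x y : Fin n → X) : extensionTuple R x y ∈ simplexDomain ℓ n := by
  have h : ∑ i : Fin (ℓ + 1), extensionCount R x y i = n := by
    have := Finset.card_eq_sum_card_fiberwise (s := (Finset.univ : Finset (Fin n)))
      (t := (Finset.univ : Finset (Fin (ℓ + 1)))) (f := fun t => R (x t) (y t))
      (fun _ _ => Finset.mem_coe.2 (Finset.mem_univ _))
    simpa [extensionCount] using this.symm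
  rw [Fin.sum_univ_succ] at h
  change ∑ i : Fin ℓ, extensionCount R x y i.succ ≤ n
  omega

/-- The extension (symmetrization) `𝒮ⁿ(𝔛)` of length `n` of `𝔛 = (X, R)`: the map
`(x, y) ↦ (τ_1(x, y), …, τ_ℓ(x, y))` on `X ^ n`, with values in `{α ∈ ℕ^ℓ | |α| ≤ n}`. -/
noncomputable def extensionScheme {X : Type*} {ℓ : ℕ} (R : X → X → Fin (ℓ + 1)) (n : ℕ) :
    (Fin n → X) → (Fin n → X) → simplexDomain ℓ n :=
  fun x y => ⟨extensionTuple R x y, extensionTuple_mem R x y⟩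

/-! ### Words and their types -/

/-! Both halves are one computation with symmetric tensors. For elements `a 0, …, a ℓ` of an algebra
let `S α` be the sum of the tensors `a (f 1) ⊗ ⋯ ⊗ a (f n)` over the words `f` in which the letter
`i ≥ 1` occurs `α i` times (`symSum`). If `a 0` is a unit and the span of the `a i` is closed under
multiplication, then `S ε_i * S α = (α i + 1) S (α + ε_i) +` terms of total degree at most `|α|`:
multiplying a letter `0` by `a i` raises the degree, multiplying any other letter does not
(`mul_symSum_unitExp`). Since `α i + 1 ≠ 0` in `ℂ`, induction on the degree makes `S α` a nonzero
multiple of the monomial `α` in the `S ε_i` plus monomials of smaller degree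
(`exists_leading_monomial`). Of the monomial order, only that it refines the total degree is used.

For `P`, take `a i = A_i` with the matrix product and `A_0 = 1`; the `S α` are then the adjacency
matrices of the extension (`adjMat_extensionScheme`). For `Q`, take `a i = |X| E_i` with the
Hadamard product, whose unit is `|X| E_0`, the all-ones matrix; up to the factor `|X|^n` the `S α`
are then the primitive idempotents of the extension (`IsIdempotentBasis.extension`). -/

theorem exists_add_unitExp {ℓ : ℕ} {α : Fin ℓ →₀ ℕ} (h : α.degree ≠ 0) :
    ∃ β i, α = β + unitExp i := by
  obtain ⟨i, hi⟩ : ∃ i, α i ≠ 0 := by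
    by_contra! h0
    rw [show α = 0 from Finsupp.ext h0] at h
    simp at h
  exact ⟨α - unitExp i, i, (tsub_add_cancel_of_le
    (Finsupp.single_le_iff.2 (Nat.one_le_iff_ne_zero.2 hi))).symm⟩

/-- The contribution of a letter to the type of a word: the letter `0` does not count. -/
noncomputable def letterExp {ℓ : ℕ} (k : Fin (ℓ + 1)) : Fin ℓ →₀ ℕ :=
  Fin.cases 0 (fun i => unitExp i) k

@[simp] theorem letterExp_zero {ℓ : ℕ} : letterExp (0 : Fin (ℓ + 1)) = 0 := rfl

@[simp] theorem letterExp_succ {ℓ : ℕ} (i : Fin ℓ) : letterExp i.succ = unitExp i := rfl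

@[simp] theorem degree_unitExp {ℓ : ℕ} (i : Fin ℓ) : (unitExp i).degree = 1 := by
  simp [unitExp]

theorem degree_letterExp_le {ℓ : ℕ} (k : Fin (ℓ + 1)) : (letterExp k).degree ≤ 1 := by
  cases k using Fin.cases <;> simp

/-- The type of a word in the letters `0, …, ℓ`: the number of occurrences of the letters
`1, …, ℓ`. -/
noncomputable def wordType {ℓ n : ℕ} (f : Fin n → Fin (ℓ + 1)) : Fin ℓ →₀ ℕ :=
  ∑ t, letterExp (f t)

theorem wordType_apply {ℓ n : ℕ} (f : Fin n → Fin (ℓ + 1)) (i : Fin ℓ) :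
    wordType f i = (Finset.univ.filter fun t => f t = i.succ).card := by
  have h : ∀ k : Fin (ℓ + 1), letterExp k i = if k = i.succ then 1 else 0 := by
    intro k
    cases k using Fin.cases with
    | zero => simp [(Fin.succ_ne_zero i).symm]
    | succ j => simp [unitExp, Finsupp.single_apply]
  simp [wordType, Finsupp.finsetSum_apply, h]

theorem degree_wordType_add_card {ℓ n : ℕ} (f : Fin n → Fin (ℓ + 1)) :
    (Finset.univ.filter fun t => f t = 0).card + (wordType f).degree = n := by
  have h : ∀ k : Fin (ℓ + 1), (if k = 0 then 1 else 0) + (letterExp k).degree = 1 := by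
    intro k
    cases k using Fin.cases <;> simp
  rw [wordType, map_sum, Finset.card_filter, ← Finset.sum_add_distrib]
  simp [h]

theorem degree_wordType_le {ℓ n : ℕ} (f : Fin n → Fin (ℓ + 1)) : (wordType f).degree ≤ n := by
  have := degree_wordType_add_card f
  omega

/-- The number of occurrences of the letter `k` in a word of length `n` and type `α`. -/
noncomputable def letterCount {ℓ : ℕ} (n : ℕ) (α : Fin ℓ →₀ ℕ) (k : Fin (ℓ + 1)) : ℕ :=
  Fin.cases (n - α.degree) (fun i => α i) k

theorem card_filter_eq_letterCount {ℓ n : ℕ} (f : Fin n → Fin (ℓ + 1)) (k : Fin (ℓ + 1)) :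
    (Finset.univ.filter fun t => f t = k).card = letterCount n (wordType f) k := by
  cases k using Fin.cases with
  | zero =>
    have := degree_wordType_add_card f
    simp only [letterCount, Fin.cases_zero]
    omega
  | succ i => simp [letterCount, wordType_apply]

/-- The type and the length determine all letter counts, that of `0` included, so bijections between
the fibres of the two words glue to a permutation. -/
theorem wordType_eq_iff {ℓ n : ℕ} {f g : Fin n → Fin (ℓ + 1)} :
    wordType f = wordType g ↔ ∃ σ : Equiv.Perm (Fin n), g ∘ σ = f := by
  constructor
  · intro h
    have e : ∀ k, Nonempty ({t // f t = k} ≃ {t // g t = k}) := fun k => by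
      rw [← Fintype.card_eq, Fintype.card_subtype, Fintype.card_subtype,
        card_filter_eq_letterCount, card_filter_eq_letterCount, h]
    exact ⟨Equiv.ofFiberEquiv fun k => (e k).some, funext fun t => Equiv.ofFiberEquiv_map _ t⟩
  · rintro ⟨σ, rfl⟩
    exact Equiv.sum_comp σ fun t => letterExp (g t)

theorem wordType_comp_perm {ℓ n : ℕ} (f : Fin n → Fin (ℓ + 1)) (σ : Equiv.Perm (Fin n)) :
    wordType (f ∘ σ) = wordType f :=
  wordType_eq_iff.2 ⟨σ, rfl⟩

theorem wordType_update {ℓ n : ℕ} (f : Fin n → Fin (ℓ + 1)) (t : Fin n) (k : Fin (ℓ + 1)) :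
    wordType (Function.update f t k) + letterExp (f t) = wordType f + letterExp k := by
  simp only [wordType]
  rw [← Finset.add_sum_erase _ _ (Finset.mem_univ t),
    ← Finset.add_sum_erase _ (fun t => letterExp (f t)) (Finset.mem_univ t),
    Finset.sum_congr rfl (g := fun s => letterExp (f s))]
  · simp only [Function.update_self]
    abel
  · intro s hs
    rw [Function.update_of_ne (Finset.ne_of_mem_erase hs)]

theorem exists_wordType_eq {ℓ n : ℕ} (α : Fin ℓ →₀ ℕ) (hα : α.degree ≤ n) :
    ∃ f : Fin n → Fin (ℓ + 1), wordType f = α := by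
  induction h : α.degree generalizing α with
  | zero =>
    rw [Finsupp.degree_eq_zero_iff] at h
    exact ⟨fun _ => 0, by simp [wordType, h]⟩
  | succ d ih =>
    obtain ⟨β, i, rfl⟩ := exists_add_unitExp (by omega : α.degree ≠ 0)
    rw [map_add, degree_unitExp] at h hα
    obtain ⟨f, rfl⟩ := ih β (by omega) (by omega)
    have hc := degree_wordType_add_card f
    obtain ⟨t, ht⟩ : (Finset.univ.filter fun t => f t = 0).Nonempty :=
      Finset.card_pos.1 (by omega)
    refine ⟨Function.update f t i.succ, ?_⟩
    have := wordType_update f t i.succ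
    simpa [(Finset.mem_filter.1 ht).2] using this

theorem wordType_zero_filter {ℓ n : ℕ} :
    (Finset.univ.filter fun f : Fin n → Fin (ℓ + 1) => wordType f = 0) = {fun _ => 0} := by
  ext f
  simp only [Finset.mem_filter, Finset.mem_univ, true_and, Finset.mem_singleton]
  constructor
  · intro h
    have := degree_wordType_add_card f
    rw [h, map_zero, add_zero] at this
    have h2 : (Finset.univ.filter fun t => f t = 0) = Finset.univ :=
      Finset.eq_univ_of_card _ (by simpa using this)
    funext t
    exact (Finset.mem_filter.1 (h2.symm.subset (Finset.mem_univ t))).2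
  · rintro rfl
    simp [wordType]

/-- Replacing one letter `j` by `k`, in all words of type `α` and in all places. -/
theorem sum_update_letter {ℓ n : ℕ} {W : Type*} [AddCommMonoid W] (F : (Fin n → Fin (ℓ + 1)) → W)
    (α : Fin ℓ →₀ ℕ) (j k : Fin (ℓ + 1)) :
    ∑ f with wordType f = α, ∑ t with f t = j, F (Function.update f t k) =
      ∑ g with wordType g + letterExp j = α + letterExp k,
        letterCount n (wordType g) k • F g := by
  have hR : ∀ g : Fin n → Fin (ℓ + 1), letterCount n (wordType g) k • F g =
      ∑ t with g t = k, F g := fun g => by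
    rw [Finset.sum_const, card_filter_eq_letterCount]
  simp only [hR]
  rw [Finset.sum_sigma', Finset.sum_sigma']
  -- Both sides now run over words with a marked position; overwriting the marked letter by `k` is
  -- undone by overwriting it by `j`.
  refine Finset.sum_bij' (fun p _ => ⟨Function.update p.1 p.2 k, p.2⟩)
    (fun p _ => ⟨Function.update p.1 p.2 j, p.2⟩) ?_ ?_ ?_ ?_ ?_
  · rintro ⟨f, t⟩ h
    simp only [Finset.mem_sigma, Finset.mem_filter, Finset.mem_univ, true_and] at h ⊢
    obtain ⟨rfl, rfl⟩ := h
    simpa using wordType_update f t k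
  · rintro ⟨g, t⟩ h
    simp only [Finset.mem_sigma, Finset.mem_filter, Finset.mem_univ, true_and] at h ⊢
    obtain ⟨h, rfl⟩ := h
    have := wordType_update g t j
    rw [h] at this
    simpa using this
  · rintro ⟨f, t⟩ h
    simp only [Finset.mem_sigma, Finset.mem_filter, Finset.mem_univ, true_and] at h
    simp [← h.2]
  · rintro ⟨g, t⟩ h
    simp only [Finset.mem_sigma, Finset.mem_filter, Finset.mem_univ, true_and] at h
    simp [← h.2]
  · intro _ _
    rfl

/-! ### Symmetrized sums of products -/

section Symmetrization

variable {V W : Type*} [AddCommGroup V] [Module ℂ V] [AddCommGroup W] [Module ℂ W] {ℓ n : ℕ}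
  (φ : MultilinearMap ℂ (fun _ : Fin n => V) W)

/-- The sum of `φ (a ∘ f)` over the words `f` of type `α`. -/
noncomputable def symSum (a : Fin (ℓ + 1) → V) (α : Fin ℓ →₀ ℕ) : W :=
  ∑ f with wordType f = α, φ fun t => a (f t)

theorem symSum_eq_zero (a : Fin (ℓ + 1) → V) {α : Fin ℓ →₀ ℕ} (hα : n < α.degree) :
    symSum φ a α = 0 := by
  refine Finset.sum_eq_zero fun f hf => ?_
  have := degree_wordType_le f
  rw [(Finset.mem_filter.1 hf).2] at this
  omega

theorem symSum_zero (a : Fin (ℓ + 1) → V) : symSum φ a 0 = φ fun _ => a 0 := by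
  rw [symSum, wordType_zero_filter, Finset.sum_singleton]

theorem symSum_smul (a : Fin (ℓ + 1) → V) (c : ℂ) (α : Fin ℓ →₀ ℕ) :
    symSum φ (fun i => c • a i) α = c ^ n • symSum φ a α := by
  simp only [symSum, Finset.smul_sum]
  refine Finset.sum_congr rfl fun f _ => ?_
  rw [MultilinearMap.map_smul_univ]
  simp

theorem symSum_unitExp (a : Fin (ℓ + 1) → V) (i : Fin ℓ) :
    symSum φ a (unitExp i) = ∑ t, φ (Function.update (fun _ => a 0) t (a i.succ)) := by
  -- The constant word `0` is the only word of type `0`, and changing one of its letters gives each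
  -- word of type `ε_i` exactly once.
  have h := sum_update_letter (n := n) (fun f => φ fun t => a (f t)) (0 : Fin ℓ →₀ ℕ) 0 i.succ
  have hs : ∀ g : Fin n → Fin (ℓ + 1), wordType g = unitExp i →
      letterCount n (wordType g) i.succ = 1 := by
    intro g hg
    simp [hg, letterCount, unitExp]
  simp only [letterExp_zero, add_zero, letterExp_succ, zero_add] at h
  rw [symSum, ← (Finset.sum_congr rfl fun g hg => by
    rw [hs g (Finset.mem_filter.1 hg).2, one_smul] :
      ∑ g with wordType g = unitExp i, letterCount n (wordType g) i.succ • φ (fun t => a (g t)) =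
        ∑ g with wordType g = unitExp i, φ fun t => a (g t)),
    ← h, wordType_zero_filter, Finset.sum_singleton]
  simp only [Finset.filter_true]
  refine Finset.sum_congr rfl fun t _ => congrArg φ ?_
  funext s
  by_cases hst : s = t
  · subst hst; simp
  · simp [hst]

/-- A sum over a permutation invariant set of words in letters that are mapped into the span of
`b` is in the span of the symmetrized sums of `b`. -/
theorem sum_mem_span_symSum {K : Type*} [Fintype K] (v : K → V) (b : Fin (ℓ + 1) → V)
    (hv : ∀ k, v k ∈ Submodule.span ℂ (Set.range b)) (P : (Fin n → K) → Prop) [DecidablePred P]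
    (hP : ∀ h (σ : Equiv.Perm (Fin n)), P h → P (h ∘ σ)) :
    ∑ h with P h, φ (fun t => v (h t)) ∈ Submodule.span ℂ (Set.range (symSum φ b)) := by
  classical
  simp only [Submodule.mem_span_range_iff_exists_fun] at hv
  choose c hc using hv
  have hex : ∀ h : Fin n → K, φ (fun t => v (h t)) =
      ∑ g : Fin n → Fin (ℓ + 1), (∏ t, c (h t) (g t)) • φ (fun t => b (g t)) := by
    intro h
    simp only [← hc, MultilinearMap.map_sum, MultilinearMap.map_smul_univ]
  simp only [hex]
  rw [Finset.sum_comm]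
  simp only [← Finset.sum_smul]
  set C : (Fin n → Fin (ℓ + 1)) → ℂ := fun g => ∑ h with P h, ∏ t, c (h t) (g t) with hC
  -- The coefficient of a word depends only on its type: permuting `g` can be compensated by
  -- permuting `h`, which preserves `P`. Grouping by type then leaves multiples of symmetrized sums.
  have hinv : ∀ g g', wordType g = wordType g' → C g = C g' := by
    intro g g' hg
    obtain ⟨σ, rfl⟩ := wordType_eq_iff.1 hg
    refine Finset.sum_equiv (σ.symm.arrowCongr (Equiv.refl K)).symm ?_ ?_
    · intro h
      simp only [Finset.mem_filter, Finset.mem_univ, true_and]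
      constructor
      · exact fun hh => hP h σ.symm hh
      · intro hh
        have := hP _ σ hh
        convert this using 1
        ext t
        simp
    · intro h _
      refine (Equiv.prod_comp σ.symm _).symm.trans ?_
      simp
  rw [← Finset.sum_fiberwise_of_maps_to (s := Finset.univ)
    (t := Finset.univ.image (wordType (ℓ := ℓ) (n := n))) (g := wordType)
    (fun g _ => Finset.mem_image_of_mem _ (Finset.mem_univ g))]
  refine Submodule.sum_mem _ fun α hα => ?_
  obtain ⟨g₀, -, rfl⟩ := Finset.mem_image.1 hα
  rw [Finset.sum_congr rfl (g := fun g => C g₀ • φ fun t => b (g t)), ← Finset.smul_sum]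
  · exact Submodule.smul_mem _ _ (Submodule.subset_span ⟨wordType g₀, rfl⟩)
  · intro g hg
    rw [← hinv g g₀ (Finset.mem_filter.1 hg).2]

theorem symSum_mem_span_symSum (a b : Fin (ℓ + 1) → V)
    (h : ∀ i, a i ∈ Submodule.span ℂ (Set.range b)) (α : Fin ℓ →₀ ℕ) :
    symSum φ a α ∈ Submodule.span ℂ (Set.range (symSum φ b)) :=
  sum_mem_span_symSum φ a b h (fun f => wordType f = α) fun f σ hf =>
    (wordType_comp_perm f σ).trans hf

/-- The symmetrized sums of restricted degree span the same space as all of them. -/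
theorem span_range_symSum (a : Fin (ℓ + 1) → V) :
    Submodule.span ℂ (Set.range (symSum φ a)) =
      Submodule.span ℂ (symSum φ a '' {α | α.degree ≤ n}) := by
  refine le_antisymm (Submodule.span_le.2 ?_) (Submodule.span_mono (Set.image_subset_range _ _))
  rintro _ ⟨α, rfl⟩
  by_cases hα : α.degree ≤ n
  · exact Submodule.subset_span ⟨α, hα, rfl⟩
  · rw [symSum_eq_zero φ a (not_le.1 hα)]
    exact Submodule.zero_mem _

variable (mulV : V →ₗ[ℂ] V →ₗ[ℂ] V) (mulW : W →ₗ[ℂ] W →ₗ[ℂ] W)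

/-- A pair of words is one word over the alphabet of pairs, and prescribing the types of both
components is a permutation invariant condition, so `sum_mem_span_symSum` applies. -/
theorem mul_symSum_mem_span
    (hφ : ∀ a b : Fin n → V, mulW (φ a) (φ b) = φ fun t => mulV (a t) (b t))
    (a : Fin (ℓ + 1) → V)
    (ha : ∀ i j, mulV (a i) (a j) ∈ Submodule.span ℂ (Set.range a)) (α β : Fin ℓ →₀ ℕ) :
    mulW (symSum φ a α) (symSum φ a β) ∈ Submodule.span ℂ (Set.range (symSum φ a)) := by
  have h := sum_mem_span_symSum φ (fun p : Fin (ℓ + 1) × Fin (ℓ + 1) => mulV (a p.1) (a p.2)) a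
    (fun p => ha p.1 p.2)
    (fun h => wordType (fun t => (h t).1) = α ∧ wordType (fun t => (h t).2) = β)
    (fun h σ hh => ⟨(wordType_comp_perm _ σ).trans hh.1, (wordType_comp_perm _ σ).trans hh.2⟩)
  convert h using 1
  simp only [symSum, map_sum, LinearMap.sum_apply, hφ]
  rw [Finset.sum_comm, Finset.sum_sigma']
  refine Finset.sum_bij' (fun p _ t => (p.1 t, p.2 t))
    (fun h _ => ⟨fun t => (h t).1, fun t => (h t).2⟩) ?_ ?_ ?_ ?_ ?_ <;> simp

/-- This recursion drives the whole proof. The factor `α i + 1` counts the places of a word of type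
`α + ε_i` in which its letter `i` may have come from a `0`; all other products act on a nonzero
letter and cannot raise the degree. -/
theorem mul_symSum_unitExp
    (hφ : ∀ a b : Fin n → V, mulW (φ a) (φ b) = φ fun t => mulV (a t) (b t))
    (a : Fin (ℓ + 1) → V)
    (ha : ∀ i j, mulV (a i) (a j) ∈ Submodule.span ℂ (Set.range a))
    (h0 : ∀ j, mulV (a 0) (a j) = a j) (h0' : ∀ i, mulV (a i) (a 0) = a i)
    (i : Fin ℓ) (α : Fin ℓ →₀ ℕ) :
    mulW (symSum φ a (unitExp i)) (symSum φ a α) -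
        ((α i : ℂ) + 1) • symSum φ a (α + unitExp i) ∈
      Submodule.span ℂ (symSum φ a '' {β | β.degree ≤ α.degree}) := by
  simp only [Submodule.mem_span_range_iff_exists_fun] at ha
  choose p hp using ha
  set F : (Fin n → Fin (ℓ + 1)) → W := fun f => φ fun t => a (f t) with hF
  have hcomp : ∀ (f : Fin n → Fin (ℓ + 1)) (t : Fin n) (k : Fin (ℓ + 1)),
      φ (Function.update (fun s => a (f s)) t (a k)) = F (Function.update f t k) := by
    intro f t k
    simp only [hF]
    congr 1
    funext s
    by_cases hs : s = t
    · subst hs; simp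
    · simp [hs]
  -- As `a 0` is a left unit, each term of `S ε_i` changes a single position `t`; positions are
  -- grouped by the letter `j` found there.
  have h1 : mulW (symSum φ a (unitExp i)) (symSum φ a α) =
      ∑ j, ∑ f with wordType f = α, ∑ t with f t = j,
        φ (Function.update (fun s => a (f s)) t (mulV (a i.succ) (a j))) := by
    rw [Finset.sum_comm, symSum_unitExp, symSum, map_sum]
    refine Finset.sum_congr rfl fun f _ => ?_
    rw [map_sum, LinearMap.sum_apply, ← Finset.sum_fiberwise (g := f)]
    refine Finset.sum_congr rfl fun j _ => Finset.sum_congr rfl fun t ht => ?_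
    rw [hφ]
    congr 1
    funext s
    by_cases hs : s = t
    · subst hs; simp [(Finset.mem_filter.1 ht).2]
    · simp [hs, h0]
  have hsum : ∀ j k, ∑ f with wordType f = α, ∑ t with f t = j, F (Function.update f t k) ∈
      Submodule.span ℂ (symSum φ a '' {β | β + letterExp j = α + letterExp k}) := by
    intro j k
    rw [sum_update_letter]
    -- The type after replacement would be `α + letterExp k - letterExp j`; if it does not exist,
    -- the sum is empty.
    by_cases hβ : ∃ β, β + letterExp j = α + letterExp k
    · obtain ⟨β, hβ⟩ := hβ
      simp only [← hβ, add_left_inj]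
      rw [Finset.sum_congr rfl (g := fun g => letterCount n β k • F g), ← Finset.smul_sum]
      · exact Submodule.smul_of_tower_mem _ _ (Submodule.subset_span ⟨β, rfl, rfl⟩)
      · intro g hg
        rw [(Finset.mem_filter.1 hg).2]
    · rw [Finset.sum_eq_zero]
      · exact Submodule.zero_mem _
      · exact fun g hg => (hβ ⟨_, (Finset.mem_filter.1 hg).2⟩).elim
  have h2 : ∑ f with wordType f = α, ∑ t with f t = 0,
        φ (Function.update (fun s => a (f s)) t (mulV (a i.succ) (a 0))) =
      ((α i : ℂ) + 1) • symSum φ a (α + unitExp i) := by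
    simp only [h0', hcomp]
    rw [sum_update_letter]
    simp only [letterExp_zero, add_zero, letterExp_succ, symSum, Finset.smul_sum]
    refine Finset.sum_congr rfl fun g hg => ?_
    rw [(Finset.mem_filter.1 hg).2, ← Nat.cast_smul_eq_nsmul ℂ]
    simp [letterCount, unitExp, hF]
  rw [h1, Fin.sum_univ_succ, h2, add_sub_cancel_left]
  refine Submodule.sum_mem _ fun j _ => ?_
  simp only [← hp, MultilinearMap.map_update_sum, MultilinearMap.map_update_smul, hcomp]
  have h3 : ∑ f with wordType f = α, ∑ t with f t = j.succ,
        ∑ k, p i.succ j.succ k • F (Function.update f t k) =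
      ∑ k, p i.succ j.succ k • ∑ f with wordType f = α, ∑ t with f t = j.succ,
        F (Function.update f t k) := by
    simp only [Finset.smul_sum]
    rw [Finset.sum_comm]
    exact Finset.sum_congr rfl fun f _ => Finset.sum_comm
  rw [h3]
  refine Submodule.sum_mem _ fun k _ => Submodule.smul_mem _ _
    (Submodule.span_mono (Set.image_mono fun β hβ => ?_) (hsum j.succ k))
  have := congrArg Finsupp.degree (show β + letterExp j.succ = α + letterExp k from hβ)
  simp only [letterExp_succ, map_add, degree_unitExp] at this
  have := degree_letterExp_le k
  simp only [Set.mem_ofPred_eq]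
  omega

end Symmetrization

/-! ### From the recursion to polynomials -/

theorem degLex_toSyn_lt {ℓ : ℕ} {α β : Fin ℓ →₀ ℕ} (h : α.degree < β.degree) :
    MonomialOrder.degLex.toSyn α < MonomialOrder.degLex.toSyn β := by
  rw [MonomialOrder.degLex_lt_iff, Finsupp.DegLex.lt_iff]
  exact Or.inl h

theorem mem_simplexDomain {ℓ n : ℕ} {α : Fin ℓ →₀ ℕ} : α ∈ simplexDomain ℓ n ↔ α.degree ≤ n := by
  rw [Finsupp.degree_eq_sum]
  rfl

theorem setOf_degree_le (ℓ n : ℕ) :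
    {α : Fin ℓ →₀ ℕ | α.degree ≤ n} = simplexDomain ℓ n :=
  Set.ext fun _ => mem_simplexDomain.symm

section Triangular

variable {W : Type*} [AddCommGroup W] [Module ℂ W] {ℓ : ℕ} {mul : W →ₗ[ℂ] W →ₗ[ℂ] W}
  {S mon : (Fin ℓ →₀ ℕ) → W}

theorem exists_leading_monomial (h0 : mon 0 = S 0)
    (hmon : ∀ i β, mul (S (unitExp i)) (mon β) = mon (β + unitExp i))
    (hrec : ∀ (i : Fin ℓ) (α : Fin ℓ →₀ ℕ),
      mul (S (unitExp i)) (S α) - ((α i : ℂ) + 1) • S (α + unitExp i) ∈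
        Submodule.span ℂ (S '' {β | β.degree ≤ α.degree})) (α : Fin ℓ →₀ ℕ) :
    ∃ c : ℂ, c ≠ 0 ∧ S α - c • mon α ∈ Submodule.span ℂ (mon '' {β | β.degree < α.degree}) := by
  induction h : α.degree using Nat.strong_induction_on generalizing α with
  | _ d ih =>
  by_cases hd : d = 0
  · subst hd
    rw [Finsupp.degree_eq_zero_iff] at h
    exact ⟨1, one_ne_zero, by simp [h, h0]⟩
  obtain ⟨α, i, rfl⟩ := exists_add_unitExp (h.trans_ne hd)
  rw [map_add, degree_unitExp] at h
  subst h
  obtain ⟨c, hc, hs⟩ := ih α.degree (by omega) α rfl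
  -- After the renaming, the target exponent is `α + ε_i`. The induction hypothesis turns the error
  -- terms of the recursion into monomials of degree below `|α| + 1`.
  have hle : Submodule.span ℂ (S '' {β | β.degree ≤ α.degree}) ≤
      Submodule.span ℂ (mon '' {β | β.degree < α.degree + 1}) := by
    rw [Submodule.span_le]
    rintro _ ⟨β, hβ, rfl⟩
    have hβ' : β.degree < α.degree + 1 := Nat.lt_succ_of_le hβ
    obtain ⟨e, -, he⟩ := ih _ hβ' β rfl
    rw [SetLike.mem_coe, ← sub_add_cancel (S β) (e • mon β)]
    refine Submodule.add_mem _ (Submodule.span_mono (Set.image_mono ?_) he)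
      (Submodule.smul_mem _ _ (Submodule.subset_span ⟨β, hβ', rfl⟩))
    exact fun γ hγ => lt_trans hγ hβ'
  have hmul : mul (S (unitExp i)) (S α - c • mon α) ∈
      Submodule.span ℂ (mon '' {β | β.degree < α.degree + 1}) := by
    have := Submodule.mem_map_of_mem (f := mul (S (unitExp i))) hs
    rw [Submodule.map_span] at this
    refine Submodule.span_mono ?_ this
    rintro _ ⟨_, ⟨β, hβ, rfl⟩, rfl⟩
    refine ⟨β + unitExp i, ?_, (hmon i β).symm⟩
    have hβ' : β.degree < α.degree := hβ
    simpa using hβ'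
  have hne : (α i : ℂ) + 1 ≠ 0 := by exact_mod_cast Nat.succ_ne_zero (α i)
  refine ⟨((α i : ℂ) + 1)⁻¹ * c, mul_ne_zero (inv_ne_zero hne) hc, ?_⟩
  have := Submodule.smul_mem _ ((α i : ℂ) + 1)⁻¹ (Submodule.sub_mem _ hmul (hle (hrec i α)))
  convert this using 1
  rw [map_sub, map_smul, hmon, smul_sub, smul_sub, smul_sub, smul_smul ((α i : ℂ) + 1)⁻¹ _ (S _),
    inv_mul_cancel₀ hne, smul_smul]
  module

theorem exists_polynomial (n : ℕ)
    {α : Fin ℓ →₀ ℕ} (hα : α.degree ≤ n) (h : ∃ c : ℂ, c ≠ 0 ∧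
      S α - c • mon α ∈ Submodule.span ℂ (mon '' {β | β.degree < α.degree})) :
    ∃ v : MvPolynomial (Fin ℓ) ℂ,
      HasMultidegreeOn MonomialOrder.degLex (simplexDomain ℓ n) α v ∧
        S α = ∑ β ∈ v.support, v.coeff β • mon β := by
  obtain ⟨c, hc, hs⟩ := h
  obtain ⟨l, hl, hlS⟩ := (Finsupp.mem_span_image_iff_linearCombination ℂ).1 hs
  have hlt : ∀ β ∈ l.support, β.degree < α.degree := fun β hβ => hl hβ
  have hlα : l α = 0 := by
    by_contra h
    exact lt_irrefl _ (hlt α (Finsupp.mem_support_iff.2 h))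
  -- The polynomial is `c x^α` plus the lower part `l`; `l` vanishes at `α`, so the leading
  -- coefficient stays `c`.
  set u : (Fin ℓ →₀ ℕ) →₀ ℂ := l + Finsupp.single α c with hu
  have huS : Finsupp.linearCombination ℂ mon u = S α := by
    rw [hu, map_add, hlS, Finsupp.linearCombination_single, sub_add_cancel]
  set v : MvPolynomial (Fin ℓ) ℂ := AddMonoidAlgebra.ofCoeff u with hv
  have hcoeff : ∀ β, v.coeff β = u β := fun β => rfl
  have hsupp : v.support = u.support := rfl
  have huα : u α = c := by simp [hu, hlα]
  have hle : ∀ β ∈ v.support, β = α ∨ β.degree < α.degree := by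
    intro β hβ
    rw [hsupp] at hβ
    by_cases h : β = α
    · exact Or.inl h
    · refine Or.inr (hlt β ?_)
      rw [Finsupp.mem_support_iff] at hβ ⊢
      simpa [hu, Finsupp.single_apply, Ne.symm h] using hβ
  have hαv : α ∈ v.support := by
    rw [hsupp, Finsupp.mem_support_iff, huα]
    exact hc
  refine ⟨v, ⟨?_, ?_, ?_⟩, ?_⟩
  · rintro h0
    rw [h0] at hαv
    simp at hαv
  · refine MonomialOrder.degLex.toSyn.injective (le_antisymm ?_ (MonomialOrder.le_degree hαv))
    rw [MonomialOrder.degree_le_iff]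
    intro β hβ
    rcases hle β hβ with rfl | h
    · exact le_rfl
    · exact (degLex_toSyn_lt h).le
  · intro β hβ
    rw [mem_simplexDomain]
    rcases hle β hβ with rfl | h
    · exact hα
    · omega
  · rw [← huS]
    rfl

/-- Only `|α| = n` needs an argument: the exponent `α + ε_i` then leaves the domain, but the
monomial still lies in the span of the `S β` with `|β| ≤ n`. These reduce to monomials of degree at
most `n`, all below `α + ε_i` in a graded order. -/
theorem mul_mon_mem_span {n : ℕ} (h0 : mon 0 = S 0)
    (hmon : ∀ i β, mul (S (unitExp i)) (mon β) = mon (β + unitExp i))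
    (hS : ∀ α β, mul (S α) (S β) ∈ Submodule.span ℂ (Set.range S))
    (hspan : Submodule.span ℂ (Set.range S) = Submodule.span ℂ (S '' {α | α.degree ≤ n}))
    (hlead : ∀ α, ∃ c : ℂ, c ≠ 0 ∧
      S α - c • mon α ∈ Submodule.span ℂ (mon '' {β | β.degree < α.degree}))
    (i : Fin ℓ) {α : Fin ℓ →₀ ℕ} (hα : α ∈ simplexDomain ℓ n) :
    mul (S (unitExp i)) (mon α) ∈ Submodule.span ℂ {M | ∃ β ∈ simplexDomain ℓ n,
      MonomialOrder.degLex.toSyn β ≤ MonomialOrder.degLex.toSyn (α + unitExp i) ∧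
        M = mon β} := by
  rw [mem_simplexDomain] at hα
  rcases hα.lt_or_eq with hlt | heq
  · refine Submodule.subset_span ⟨α + unitExp i, ?_, le_rfl, hmon i α⟩
    rw [mem_simplexDomain, map_add, degree_unitExp]
    exact hlt
  · have hmem : ∀ β, mon β ∈ Submodule.span ℂ (Set.range S) := by
      intro β
      induction hd : β.degree generalizing β with
      | zero =>
        rw [Finsupp.degree_eq_zero_iff] at hd
        rw [hd, h0]
        exact Submodule.subset_span ⟨0, rfl⟩
      | succ d ih =>
        obtain ⟨β, j, rfl⟩ := exists_add_unitExp (by omega : β.degree ≠ 0)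
        rw [map_add, degree_unitExp] at hd
        rw [← hmon]
        have := Submodule.mem_map_of_mem (f := mul (S (unitExp j))) (ih β (by omega))
        rw [Submodule.map_span] at this
        refine (Submodule.span_le.2 ?_) this
        rintro _ ⟨_, ⟨γ, rfl⟩, rfl⟩
        exact hS _ _
    rw [hmon]
    refine (hspan.le.trans (Submodule.span_le.2 ?_)) (hmem (α + unitExp i))
    rintro _ ⟨β, hβ : β.degree ≤ n, rfl⟩
    obtain ⟨c, -, hc⟩ := hlead β
    have hsub : ∀ γ : Fin ℓ →₀ ℕ, γ.degree ≤ n → mon γ ∈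
        Submodule.span ℂ {M | ∃ β ∈ simplexDomain ℓ n,
          MonomialOrder.degLex.toSyn β ≤ MonomialOrder.degLex.toSyn (α + unitExp i) ∧
            M = mon β} := by
      intro γ hγ
      refine Submodule.subset_span ⟨γ, mem_simplexDomain.2 hγ, (degLex_toSyn_lt ?_).le, rfl⟩
      rw [map_add, degree_unitExp]
      omega
    rw [SetLike.mem_coe, ← sub_add_cancel (S β) (c • mon β)]
    refine Submodule.add_mem _ ((Submodule.span_le.2 ?_) hc) (Submodule.smul_mem _ _ (hsub β hβ))
    rintro _ ⟨γ, hγ : γ.degree < β.degree, rfl⟩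
    exact hsub γ (by omega)

end Triangular

/-! ### Matrices on a power of a set -/

/-- The tensor product of `n` matrices, as a matrix on `X ^ n`. -/
def tensorPow (X : Type*) (n : ℕ) :
    MultilinearMap ℂ (fun _ : Fin n => Matrix X X ℂ) (Matrix (Fin n → X) (Fin n → X) ℂ) :=
  -- The instance is arbitrary because the fields of `MultilinearMap` quantify over it.
  have key : ∀ [DecidableEq (Fin n)] (m : Fin n → Matrix X X ℂ) (i : Fin n) (c : Matrix X X ℂ)
      (x y : Fin n → X), ∏ t, Function.update m i c t (x t) (y t) =
        c (x i) (y i) * ∏ t ∈ Finset.univ.erase i, m t (x t) (y t) := by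
    intro _ m i c x y
    rw [← Finset.mul_prod_erase _ _ (Finset.mem_univ i), Function.update_self]
    congr 1
    refine Finset.prod_congr (by congr!) fun t ht => ?_
    rw [Function.update_of_ne (Finset.ne_of_mem_erase ht)]
  { toFun := fun A => Matrix.of fun x y => ∏ t, A t (x t) (y t)
    map_update_add' := by
      intro _ m i a b
      ext x y
      simp [key, add_mul]
    map_update_smul' := by
      intro _ m i c a
      ext x y
      simp [key, mul_assoc] }

theorem tensorPow_apply {X : Type*} {n : ℕ} (A : Fin n → Matrix X X ℂ) (x y : Fin n → X) :
    tensorPow X n A x y = ∏ t, A t (x t) (y t) := rfl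

theorem tensorPow_mul {X : Type*} [Fintype X] {n : ℕ} (A B : Fin n → Matrix X X ℂ) :
    tensorPow X n A * tensorPow X n B = tensorPow X n fun t => A t * B t := by
  ext x y
  simp only [Matrix.mul_apply, tensorPow_apply, ← Finset.prod_mul_distrib, Finset.prod_univ_sum,
    Fintype.piFinset_univ]

theorem tensorPow_one {X : Type*} [Fintype X] [DecidableEq X] {n : ℕ} :
    tensorPow X n (fun _ => 1) = 1 := by
  ext x y
  simp only [tensorPow_apply, Matrix.one_apply, Finset.prod_ite_zero, Finset.mem_univ,
    forall_const, Finset.prod_const_one, funext_iff]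

theorem tensorPow_hadamard {X : Type*} {n : ℕ} (A B : Fin n → Matrix X X ℂ) :
    tensorPow X n A ⊙ tensorPow X n B = tensorPow X n fun t => A t ⊙ B t := by
  ext x y
  simp [tensorPow_apply, Finset.prod_mul_distrib]

/-- The Hadamard product as a bilinear map. -/
def hadamardBilin (X : Type*) : Matrix X X ℂ →ₗ[ℂ] Matrix X X ℂ →ₗ[ℂ] Matrix X X ℂ :=
  LinearMap.mk₂ ℂ (fun A B => A ⊙ B) (fun _ _ _ => Matrix.add_hadamard _ _ _)
    (fun _ _ _ => Matrix.smul_hadamard _ _ _) (fun _ _ _ => Matrix.hadamard_add _ _ _)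
    (fun _ _ _ => Matrix.hadamard_smul _ _ _)

@[simp] theorem hadamardBilin_apply {X : Type*} (A B : Matrix X X ℂ) :
    hadamardBilin X A B = A ⊙ B := rfl

theorem mul_prod_ofFn {A : Type*} [Monoid A] {ℓ : ℕ} (g : Fin ℓ → A) (a : A) (i : Fin ℓ)
    (h : ∀ j, Commute a (g j)) :
    a * (List.ofFn g).prod = (List.ofFn (Function.update g i (a * g i))).prod := by
  induction ℓ with
  | zero => exact i.elim0
  | succ ℓ ih =>
    rw [List.ofFn_succ, List.ofFn_succ, List.prod_cons, List.prod_cons]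
    cases i using Fin.cases with
    | zero => simp [mul_assoc]
    | succ j =>
      have := ih (fun k => g k.succ) j fun k => h k.succ
      rw [← mul_assoc, (h 0).eq, mul_assoc, this, Function.update_of_ne (Fin.succ_ne_zero j).symm]
      congr 4
      funext k
      by_cases hk : k = j
      · subst hk; simp
      · simp [hk]

theorem mul_matMonomial {X : Type*} [Fintype X] [DecidableEq X] {ℓ : ℕ}
    {M : Fin ℓ → Matrix X X ℂ} (hM : ∀ i j, Commute (M i) (M j)) (i : Fin ℓ) (β : Fin ℓ →₀ ℕ) :
    M i * matMonomial M β = matMonomial M (β + unitExp i) := by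
  rw [matMonomial, mul_prod_ofFn _ _ i fun j => (hM i j).pow_right _, matMonomial]
  congr 2
  funext k
  by_cases hk : k = i
  · subst hk; simp [unitExp, pow_succ']
  · simp [unitExp, hk]

theorem matMonomial_zero {X : Type*} [Fintype X] [DecidableEq X] {ℓ : ℕ}
    (M : Fin ℓ → Matrix X X ℂ) : matMonomial M 0 = 1 := by
  simp [matMonomial]

theorem hadamard_hadMonomial {X : Type*} {ℓ : ℕ} (M : Fin ℓ → Matrix X X ℂ) (i : Fin ℓ)
    (β : Fin ℓ →₀ ℕ) : M i ⊙ hadMonomial M β = hadMonomial M (β + unitExp i) := by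
  ext x y
  simp only [hadMonomial, Matrix.hadamard_apply, Matrix.of_apply, Finsupp.add_apply, pow_add,
    Finset.prod_mul_distrib]
  rw [mul_comm]
  congr 1
  rw [Finset.prod_eq_single i]
  · simp [unitExp]
  · intro j _ hj
    simp [unitExp, Ne.symm hj]
  · simp

/-! ### Relabelling the relations of a scheme -/

theorem adjMat_apply {X I : Type*} [DecidableEq I] (R : X → X → I) (i : I) (x y : X) :
    adjMat R i x y = if R x y = i then 1 else 0 := by
  simp only [adjMat, Matrix.of_apply]
  congr

theorem adjMat_injective {X I : Type*} {R : X → X → I}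
    (h : Function.Surjective (Function.uncurry R)) : Function.Injective (adjMat R) := by
  classical
  intro i j hij
  obtain ⟨⟨x, y⟩, hxy⟩ := h i
  have := congrFun (congrFun hij x) y
  simp only [Function.uncurry_apply_pair] at hxy
  simpa [adjMat_apply, hxy] using this

theorem range_adjMat_congr {X I J : Type*} {R : X → X → I} {S : X → X → J}
    (hR : Function.Surjective (Function.uncurry R)) (hS : Function.Surjective (Function.uncurry S))
    (h : ∀ x y u v, R x y = R u v ↔ S x y = S u v) :
    Set.range (adjMat R) = Set.range (adjMat S) := by
  classical
  have key : ∀ x y, adjMat R (R x y) = adjMat S (S x y) := by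
    intro x y
    ext u v
    simp only [adjMat_apply, h]
  apply subset_antisymm
  · rintro _ ⟨i, rfl⟩
    obtain ⟨⟨x, y⟩, rfl⟩ := hR i
    exact ⟨S x y, (key x y).symm⟩
  · rintro _ ⟨i, rfl⟩
    obtain ⟨⟨x, y⟩, rfl⟩ := hS i
    exact ⟨R x y, key x y⟩

/-- Apart from surjectivity, every axiom is put in terms of the set of adjacency matrices, which
makes invariance under relabelling immediate. -/
theorem isCommAssocScheme_iff {X I : Type*} [Fintype X] [DecidableEq X] [Fintype I]
    {R : X → X → I} : IsCommAssocScheme R ↔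
      Function.Surjective (Function.uncurry R) ∧ 1 ∈ Set.range (adjMat R) ∧
      (∀ A ∈ Set.range (adjMat R), Aᵀ ∈ Set.range (adjMat R)) ∧
      (∀ A ∈ Set.range (adjMat R), ∀ B ∈ Set.range (adjMat R),
        A * B ∈ Submodule.span ℂ (Set.range (adjMat R))) ∧
      ∀ A ∈ Set.range (adjMat R), ∀ B ∈ Set.range (adjMat R), A * B = B * A := by
  simp only [Set.forall_mem_range]
  constructor
  · intro h
    obtain ⟨p, hp⟩ := h.exists_intersection
    refine ⟨h.surjective, h.exists_one, fun i => ?_, fun i j => ?_, h.comm⟩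
    · obtain ⟨j, hj⟩ := h.exists_transpose i
      exact ⟨j, hj.symm⟩
    · exact (Submodule.mem_span_range_iff_exists_fun ℂ).2 ⟨p i j, (hp i j).symm⟩
  · rintro ⟨h1, h2, h3, h4, h5⟩
    simp only [Submodule.mem_span_range_iff_exists_fun] at h4
    choose p hp using h4
    refine ⟨h1, h2, fun i => ?_, ⟨p, fun i j => (hp i j).symm⟩, h5⟩
    obtain ⟨j, hj⟩ := h3 i
    exact ⟨j, hj.symm⟩

theorem IsCommAssocScheme.congr {X I J : Type*} [Fintype X] [DecidableEq X] [Fintype I] [Fintype J]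
    {R : X → X → I} {S : X → X → J} (hR : IsCommAssocScheme R)
    (hS : Function.Surjective (Function.uncurry S))
    (h : Set.range (adjMat R) = Set.range (adjMat S)) : IsCommAssocScheme S := by
  rw [isCommAssocScheme_iff] at hR ⊢
  rw [← h]
  exact ⟨hS, hR.2⟩

theorem IsPPolynomial.congr {X I J : Type*} [Fintype X] [DecidableEq X] [Fintype I] [Fintype J]
    {ℓ : ℕ} {m : MonomialOrder (Fin ℓ)} {D : Set (Fin ℓ →₀ ℕ)}
    {R : X → X → I} {S : X → X → J} (hR : IsPPolynomial m D R)
    (hS : Function.Surjective (Function.uncurry S))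
    (h : Set.range (adjMat R) = Set.range (adjMat S)) : IsPPolynomial m D S :=
  ⟨hR.toIsCommAssocScheme.congr hS h, hR.unit_mem, hR.lower, h ▸ hR.relabel⟩

theorem IsPrimIdem.congr {X I J : Type*} [Fintype X] {R : X → X → I} {S : X → X → J}
    (h : Set.range (adjMat R) = Set.range (adjMat S)) {E : Matrix X X ℂ} (hE : IsPrimIdem R E) :
    IsPrimIdem S E := by
  have h' : boseMesner R = boseMesner S := by rw [boseMesner, h, boseMesner]
  exact ⟨h' ▸ hE.mem, hE.ne_zero, hE.idem, h' ▸ hE.primitive⟩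

theorem IsQPolynomial.congr {X I J : Type*} [Fintype X] [DecidableEq X] [Fintype I] [Fintype J]
    {ℓ : ℕ} {m : MonomialOrder (Fin ℓ)} {D : Set (Fin ℓ →₀ ℕ)}
    {R : X → X → I} {S : X → X → J} (hR : IsQPolynomial m D R)
    (hS : Function.Surjective (Function.uncurry S))
    (h : Set.range (adjMat R) = Set.range (adjMat S)) : IsQPolynomial m D S := by
  have h' : {F | IsPrimIdem R F} = {F | IsPrimIdem S F} :=
    Set.ext fun F => ⟨fun hF => hF.congr h, fun hF => hF.congr h.symm⟩
  exact ⟨hR.toIsCommAssocScheme.congr hS h, hR.unit_mem, hR.lower, h' ▸ hR.relabel⟩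

/-! ### The extension of a scheme -/

section Extension

variable {X : Type*} {ℓ n : ℕ} {R : X → X → Fin (ℓ + 1)}

theorem extensionTuple_eq_wordType (R : X → X → Fin (ℓ + 1)) (x y : Fin n → X) :
    extensionTuple R x y = wordType fun t => R (x t) (y t) := by
  ext i
  rw [wordType_apply]
  rfl

theorem extensionScheme_eq_iff {x y u v : Fin n → X} :
    extensionScheme R n x y = extensionScheme R n u v ↔
      wordType (fun t => R (x t) (y t)) = wordType fun t => R (u t) (v t) := by
  rw [← extensionTuple_eq_wordType, ← extensionTuple_eq_wordType]
  exact Subtype.ext_iff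

/-- Recoding letters commutes with permuting positions. This serves both for relabelling the
relations and for transposing them. -/
theorem wordType_comp_congr {f g : Fin n → Fin (ℓ + 1)} (h : wordType f = wordType g)
    (τ : Fin (ℓ + 1) → Fin (ℓ + 1)) : wordType (fun t => τ (f t)) = wordType fun t => τ (g t) := by
  obtain ⟨σ, rfl⟩ := wordType_eq_iff.1 h
  exact wordType_comp_perm (fun t => τ (g t)) σ

theorem extensionScheme_surjective (hR : Function.Surjective (Function.uncurry R)) :
    Function.Surjective (Function.uncurry (extensionScheme R n)) := by
  rintro ⟨α, hα⟩
  obtain ⟨f, rfl⟩ := exists_wordType_eq α (mem_simplexDomain.1 hα)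
  choose z hz using hR
  refine ⟨(fun t => (z (f t)).1, fun t => (z (f t)).2), Subtype.ext ?_⟩
  refine (extensionTuple_eq_wordType _ _ _).trans (congrArg wordType (funext fun t => hz (f t)))

/-- Which letter the type leaves uncounted is immaterial, so the identity relation may be given the
label `0`. -/
theorem range_adjMat_extension_relabel (hR : Function.Surjective (Function.uncurry R))
    (σ : Equiv.Perm (Fin (ℓ + 1))) :
    Set.range (adjMat (extensionScheme (fun x y => σ (R x y)) n)) =
      Set.range (adjMat (extensionScheme R n)) := by
  refine range_adjMat_congr (extensionScheme_surjective (σ.surjective.comp hR))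
    (extensionScheme_surjective hR) fun x y u v => ?_
  rw [extensionScheme_eq_iff, extensionScheme_eq_iff]
  refine ⟨fun h => ?_, fun h => wordType_comp_congr h σ⟩
  simpa using wordType_comp_congr h σ.symm

/-- At the entry `(x, y)` only the word `t ↦ R (x t) (y t)` contributes, so the sum tests the type
of that word. -/
theorem adjMat_extensionScheme (R : X → X → Fin (ℓ + 1)) (α : simplexDomain ℓ n) :
    adjMat (extensionScheme R n) α = symSum (tensorPow X n) (adjMat R) α := by
  classical
  ext x y
  have h : ∀ f : Fin n → Fin (ℓ + 1), tensorPow X n (fun t => adjMat R (f t)) x y =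
      if f = (fun t => R (x t) (y t)) then 1 else 0 := by
    intro f
    simp only [tensorPow_apply, adjMat_apply, Finset.prod_ite_zero, Finset.prod_const_one,
      Finset.mem_univ, forall_const, funext_iff, eq_comm]
  rw [symSum, Matrix.sum_apply]
  simp only [h, Finset.sum_ite_eq', Finset.mem_filter, Finset.mem_univ, true_and, adjMat_apply]
  rw [← extensionTuple_eq_wordType]
  exact if_congr Subtype.ext_iff rfl rfl

theorem range_adjMat_extensionScheme (R : X → X → Fin (ℓ + 1)) (n : ℕ) :
    Set.range (adjMat (extensionScheme R n)) =
      symSum (tensorPow X n) (adjMat R) '' simplexDomain ℓ n := by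
  rw [Set.image_eq_range]
  exact congrArg Set.range (funext fun α => adjMat_extensionScheme R α)

theorem boseMesner_extensionScheme (R : X → X → Fin (ℓ + 1)) (n : ℕ) :
    boseMesner (extensionScheme R n) =
      Submodule.span ℂ (Set.range (symSum (tensorPow X n) (adjMat R))) := by
  rw [span_range_symSum, boseMesner, range_adjMat_extensionScheme, setOf_degree_le]

variable [Fintype X] [DecidableEq X]

theorem IsCommAssocScheme.mul_mem_span (hR : IsCommAssocScheme R) (i j : Fin (ℓ + 1)) :
    adjMat R i * adjMat R j ∈ Submodule.span ℂ (Set.range (adjMat R)) :=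
  (isCommAssocScheme_iff.1 hR).2.2.2.1 _ ⟨i, rfl⟩ _ ⟨j, rfl⟩

theorem symSum_adjMat_mul_mem_span (hR : IsCommAssocScheme R) (α β : Fin ℓ →₀ ℕ) :
    symSum (tensorPow X n) (adjMat R) α * symSum (tensorPow X n) (adjMat R) β ∈
      Submodule.span ℂ (Set.range (symSum (tensorPow X n) (adjMat R))) :=
  mul_symSum_mem_span (tensorPow X n) (LinearMap.mul ℂ (Matrix X X ℂ))
    (LinearMap.mul ℂ (Matrix (Fin n → X) (Fin n → X) ℂ)) tensorPow_mul (adjMat R)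
    hR.mul_mem_span α β

theorem symSum_adjMat_mul_comm (hR : IsCommAssocScheme R) (α β : Fin ℓ →₀ ℕ) :
    symSum (tensorPow X n) (adjMat R) α * symSum (tensorPow X n) (adjMat R) β =
      symSum (tensorPow X n) (adjMat R) β * symSum (tensorPow X n) (adjMat R) α := by
  simp only [symSum, Finset.sum_mul_sum, tensorPow_mul]
  rw [Finset.sum_comm]
  simp only [hR.comm]

theorem IsCommAssocScheme.extension (hR : IsCommAssocScheme R) (h0 : adjMat R 0 = 1) :
    IsCommAssocScheme (extensionScheme R n) := by
  classical
  have hsurj := extensionScheme_surjective (n := n) hR.surjective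
  refine isCommAssocScheme_iff.2 ⟨hsurj, ?_, ?_, ?_, ?_⟩
  · rw [range_adjMat_extensionScheme]
    exact ⟨0, by simp [mem_simplexDomain], by rw [symSum_zero, h0, tensorPow_one]⟩
  · choose τ hτ using hR.exists_transpose
    have hτR : ∀ x y, R y x = τ (R x y) := by
      intro x y
      have := congrFun (congrFun (hτ (R x y)) y) x
      by_contra h
      simp [adjMat_apply, h] at this
    have hsymm : ∀ x y u v : Fin n → X, extensionScheme R n x y = extensionScheme R n u v →
        extensionScheme R n y x = extensionScheme R n v u := by
      intro x y u v h
      rw [extensionScheme_eq_iff] at h ⊢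
      simp only [fun t => hτR (x t) (y t), fun t => hτR (u t) (v t)]
      exact wordType_comp_congr h τ
    rintro _ ⟨α, rfl⟩
    obtain ⟨⟨x, y⟩, rfl⟩ := hsurj α
    refine ⟨extensionScheme R n y x, ?_⟩
    ext u v
    simp only [Matrix.transpose_apply, adjMat_apply, Function.uncurry_apply_pair]
    exact if_congr ⟨hsymm _ _ _ _, hsymm _ _ _ _⟩ rfl rfl
  · intro A hA B hB
    have := boseMesner_extensionScheme R n
    rw [boseMesner] at this
    rw [this]
    rw [range_adjMat_extensionScheme] at hA hB
    obtain ⟨α, -, rfl⟩ := hA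
    obtain ⟨β, -, rfl⟩ := hB
    exact symSum_adjMat_mul_mem_span hR α β
  · intro A hA B hB
    rw [range_adjMat_extensionScheme] at hA hB
    obtain ⟨α, -, rfl⟩ := hA
    obtain ⟨β, -, rfl⟩ := hB
    exact symSum_adjMat_mul_comm hR α β

theorem unitExp_mem_simplexDomain (hn : 1 ≤ n) (i : Fin ℓ) : unitExp i ∈ simplexDomain ℓ n := by
  rw [mem_simplexDomain, degree_unitExp]
  exact hn

theorem simplexDomain_lower (α : Fin ℓ →₀ ℕ) (hα : α ∈ simplexDomain ℓ n) (β : Fin ℓ →₀ ℕ)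
    (h : ∀ i, β i ≤ α i) : β ∈ simplexDomain ℓ n :=
  (Finset.sum_le_sum fun i _ => h i).trans hα

theorem IsCommAssocScheme.extension_isPPolynomial (hn : 1 ≤ n) (hR : IsCommAssocScheme R)
    (h0 : adjMat R 0 = 1) :
    IsPPolynomial MonomialOrder.degLex (simplexDomain ℓ n) (extensionScheme R n) := by
  have hsurj := extensionScheme_surjective (n := n) hR.surjective
  set S := symSum (tensorPow X n) (adjMat R) with hS
  set mon := matMonomial fun i => S (unitExp i) with hmon
  have hz : mon 0 = S 0 := by rw [hmon, matMonomial_zero, hS, symSum_zero, h0, tensorPow_one]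
  have hm : ∀ i β, LinearMap.mul ℂ _ (S (unitExp i)) (mon β) = mon (β + unitExp i) := fun i β =>
    mul_matMonomial (M := fun i => S (unitExp i))
      (fun i j => symSum_adjMat_mul_comm hR (unitExp i) (unitExp j)) i β
  have hlead := exists_leading_monomial hz hm
    (mul_symSum_unitExp (tensorPow X n) (LinearMap.mul ℂ _) (LinearMap.mul ℂ _) tensorPow_mul
      (adjMat R) hR.mul_mem_span (by simp [h0]) (by simp [h0]))
  refine ⟨hR.extension h0, unitExp_mem_simplexDomain hn, simplexDomain_lower, S, ⟨?_, ?_, ?_⟩,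
    fun α hα => ?_, fun i α hα => ?_⟩
  · rw [range_adjMat_extensionScheme]
    exact Set.mapsTo_image _ _
  · intro α hα β hβ h
    have := adjMat_injective hsurj (a₁ := ⟨α, hα⟩) (a₂ := ⟨β, hβ⟩)
      (by rw [adjMat_extensionScheme, adjMat_extensionScheme]; exact h)
    exact congrArg Subtype.val this
  · rw [range_adjMat_extensionScheme]
    exact Set.surjOn_image _ _
  · exact exists_polynomial n (mem_simplexDomain.1 hα) (hlead α)
  · exact mul_mon_mem_span hz hm (symSum_adjMat_mul_mem_span hR) (span_range_symSum _ _) hlead i hα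

end Extension

universe u

/-! ### Primitive idempotents -/

/-- A finite-dimensional reduced commutative complex algebra has a basis of orthogonal
idempotents. -/
theorem exists_basis_orthogonal_idempotents {A : Type u} [CommRing A] [Algebra ℂ A]
    [Module.Finite ℂ A] [IsReduced A] :
    ∃ (ι : Type u) (_ : Fintype ι) (_ : DecidableEq ι) (b : Module.Basis ι ℂ A),
      ∀ i j, b i * b j = if i = j then b i else 0 := by
  classical
  have : IsArtinianRing A := IsArtinianRing.of_finite ℂ A
  -- A reduced Artinian ring is the product of its residue fields, here finite extensions of `ℂ` and
  -- hence `ℂ` itself; the basis is that of the coordinate vectors.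
  let q : ∀ I : MaximalSpectrum A, (A ⧸ I.asIdeal) ≃ₐ[ℂ] ℂ := fun I =>
    haveI := I.isMaximal
    letI := Ideal.Quotient.field I.asIdeal
    (AlgEquiv.ofBijective (Algebra.ofId ℂ (A ⧸ I.asIdeal))
      IsAlgClosed.algebraMap_bijective_of_isIntegral).symm
  let e : A ≃ₐ[ℂ] (MaximalSpectrum A → ℂ) :=
    ((IsArtinianRing.equivPi A).restrictScalars ℂ).trans (AlgEquiv.piCongrRight q)
  have : Fintype (MaximalSpectrum A) := Fintype.ofFinite _
  refine ⟨MaximalSpectrum A, this, inferInstance, Module.Basis.ofEquivFun e.toLinearEquiv,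
    fun i j => e.injective ?_⟩
  have he : ∀ k, e (Module.Basis.ofEquivFun e.toLinearEquiv k) = Pi.single k 1 := fun k => by
    rw [Module.Basis.coe_ofEquivFun]
    exact e.apply_symm_apply _
  rw [map_mul, apply_ite e, map_zero, he, he]
  split_ifs with h
  · rw [h, ← Pi.single_mul, one_mul]
  · ext k
    simp only [Pi.mul_apply, Pi.single_apply, Pi.zero_apply]
    split_ifs <;> simp_all

theorem exists_basis_orthogonal_idempotents_of_comm {A : Type u} [Ring A] [Algebra ℂ A]
    [Module.Finite ℂ A] (hcomm : ∀ x y : A, x * y = y * x) (hred : ∀ x : A, x * x = 0 → x = 0) :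
    ∃ (ι : Type u) (_ : Fintype ι) (_ : DecidableEq ι) (b : Module.Basis ι ℂ A),
      ∀ i j, b i * b j = if i = j then b i else 0 := by
  let _ : CommRing A := { (inferInstance : Ring A) with mul_comm := hcomm }
  have : IsReduced A := (isReduced_iff_pow_one_lt 2 one_lt_two).2 fun x hx =>
    hred x (by rwa [sq] at hx)
  exact exists_basis_orthogonal_idempotents

/-- `E` is a family of nonzero orthogonal idempotents that spans the Bose-Mesner algebra. -/
structure IsIdempotentBasis {X I ι : Type*} [Fintype X] (R : X → X → I)
    (E : ι → Matrix X X ℂ) : Prop where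
  ne_zero : ∀ i, E i ≠ 0
  idem : ∀ i, E i * E i = E i
  orthogonal : ∀ i j, i ≠ j → E i * E j = 0
  span_eq : Submodule.span ℂ (Set.range E) = boseMesner R

namespace IsIdempotentBasis

variable {X I ι : Type*} [Fintype X] {R : X → X → I} {E : ι → Matrix X X ℂ}

theorem injective (h : IsIdempotentBasis R E) : Function.Injective E := by
  intro i j hij
  by_contra hne
  have := h.orthogonal i j hne
  rw [← hij, h.idem] at this
  exact h.ne_zero i this

theorem exists_mul_eq_smul [Finite ι] (h : IsIdempotentBasis R E) {F : Matrix X X ℂ} (hF : F ∈ boseMesner R) :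
    ∃ c : ι → ℂ, (∀ i, F * E i = c i • E i) ∧ (F ≠ 0 → ∃ i, c i ≠ 0) := by
  classical
  have : Fintype ι := Fintype.ofFinite ι
  rw [← h.span_eq, Submodule.mem_span_range_iff_exists_fun] at hF
  obtain ⟨c, rfl⟩ := hF
  refine ⟨c, fun i => ?_, fun hne => ?_⟩
  · rw [Finset.sum_mul, Finset.sum_eq_single i]
    · rw [Matrix.smul_mul, h.idem]
    · intro j _ hj
      rw [Matrix.smul_mul, h.orthogonal j i hj, smul_zero]
    · simp
  · by_contra! hc
    simp [hc] at hne

theorem smul_eq_zero_or_eq (h : IsIdempotentBasis R E) {i : ι} {c : ℂ}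
    (hc : (c • E i) * (c • E i) = c • E i) : c = 0 ∨ c = 1 := by
  rw [Matrix.smul_mul, Matrix.mul_smul, h.idem, smul_smul] at hc
  have : c * c = c := smul_left_injective ℂ (h.ne_zero i) hc
  by_cases h0 : c = 0
  · exact Or.inl h0
  · exact Or.inr (mul_left_cancel₀ h0 (by rw [this, mul_one]))

/-- An idempotent of the algebra acts on each `E i` as `0` or `1`. If a primitive `F` acts as `1` on
`E i`, the splitting `F = E i + (F - E i)` forces `F = E i`; conversely a summand of `E i` is `0` or
`E i`. -/
theorem isPrimIdem_iff [Finite ι] (h : IsIdempotentBasis R E)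
    (hcomm : ∀ A ∈ boseMesner R, ∀ B ∈ boseMesner R, A * B = B * A) {F : Matrix X X ℂ} :
    IsPrimIdem R F ↔ F ∈ Set.range E := by
  have hmem : ∀ i, E i ∈ boseMesner R := fun i =>
    h.span_eq ▸ Submodule.subset_span ⟨i, rfl⟩
  have hmul : ∀ {F}, F ∈ boseMesner R → F * F = F → ∀ {i : ι} {c : ℂ}, F * E i = c • E i →
      c = 0 ∨ c = 1 := by
    intro F hF hFF i c hc
    refine h.smul_eq_zero_or_eq (i := i) ?_
    rw [← hc, Matrix.mul_assoc, ← Matrix.mul_assoc (E i), hcomm _ (hmem i) _ hF,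
      Matrix.mul_assoc F, h.idem, ← Matrix.mul_assoc, hFF]
  constructor
  · intro hF
    obtain ⟨c, hc, hne⟩ := h.exists_mul_eq_smul hF.mem
    obtain ⟨i, hi⟩ := hne hF.ne_zero
    have hi1 : F * E i = E i := by
      rcases hmul hF.mem hF.idem (hc i) with h0 | h1
      · exact absurd h0 hi
      · rw [hc, h1, one_smul]
    have hi2 : E i * F = E i := by rw [hcomm _ (hmem i) _ hF.mem, hi1]
    rcases hF.primitive (E i) (hmem i) (F - E i) (Submodule.sub_mem _ hF.mem (hmem i)) (h.idem i)
      (by simp [Matrix.mul_sub, Matrix.sub_mul, hF.idem, hi1, hi2, h.idem])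
      (by simp [Matrix.mul_sub, hi2, h.idem]) (by simp [Matrix.sub_mul, hi1, h.idem])
      (by simp) with h0 | h0
    · exact absurd h0 (h.ne_zero i)
    · exact ⟨i, (sub_eq_zero.1 h0).symm⟩
  · rintro ⟨i, rfl⟩
    refine ⟨hmem i, h.ne_zero i, h.idem i, fun F hF G hG hFF hGG hFG hGF hsum => ?_⟩
    obtain ⟨c, hc, -⟩ := h.exists_mul_eq_smul hF
    have hFi : F * E i = F := by rw [hsum, Matrix.mul_add, hFF, hFG, add_zero]
    rcases hmul hF hFF (hc i) with h0 | h1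
    · left
      rw [← hFi, hc, h0, zero_smul]
    · right
      rw [← hFi, hc, h1, one_smul] at hsum
      simpa using hsum

end IsIdempotentBasis

/-! ### Closure properties and semisimplicity of the Bose–Mesner algebra -/

section BoseMesner

variable {X I : Type*} [Fintype I] {R : X → X → I}

theorem boseMesner_hadamard {A B : Matrix X X ℂ} (hA : A ∈ boseMesner R) (hB : B ∈ boseMesner R) :
    A ⊙ B ∈ boseMesner R := by
  classical
  obtain ⟨c, rfl⟩ := (Submodule.mem_span_range_iff_exists_fun ℂ).1 hA
  obtain ⟨d, rfl⟩ := (Submodule.mem_span_range_iff_exists_fun ℂ).1 hB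
  refine (Submodule.mem_span_range_iff_exists_fun ℂ).2 ⟨fun i => c i * d i, ?_⟩
  ext x y
  simp [Matrix.sum_apply, adjMat_apply]

theorem ones_mem_boseMesner (R : X → X → I) : (Matrix.of fun _ _ => 1) ∈ boseMesner R := by
  classical
  refine (Submodule.mem_span_range_iff_exists_fun ℂ).2 ⟨fun _ => 1, ?_⟩
  ext x y
  simp [Matrix.sum_apply, adjMat_apply]

variable [Fintype X] [DecidableEq X]

namespace IsCommAssocScheme

theorem boseMesner_comm (hR : IsCommAssocScheme R) {A B : Matrix X X ℂ} (hA : A ∈ boseMesner R)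
    (hB : B ∈ boseMesner R) : A * B = B * A := by
  obtain ⟨c, rfl⟩ := (Submodule.mem_span_range_iff_exists_fun ℂ).1 hA
  obtain ⟨d, rfl⟩ := (Submodule.mem_span_range_iff_exists_fun ℂ).1 hB
  rw [Finset.sum_mul_sum, Finset.sum_mul_sum, Finset.sum_comm]
  refine Finset.sum_congr rfl fun i _ => Finset.sum_congr rfl fun j _ => ?_
  rw [Matrix.smul_mul, Matrix.mul_smul, Matrix.smul_mul, Matrix.mul_smul, hR.comm, smul_comm]

theorem boseMesner_mul (hR : IsCommAssocScheme R) {A B : Matrix X X ℂ} (hA : A ∈ boseMesner R)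
    (hB : B ∈ boseMesner R) : A * B ∈ boseMesner R := by
  obtain ⟨c, rfl⟩ := (Submodule.mem_span_range_iff_exists_fun ℂ).1 hA
  obtain ⟨d, rfl⟩ := (Submodule.mem_span_range_iff_exists_fun ℂ).1 hB
  rw [Finset.sum_mul_sum]
  refine Submodule.sum_mem _ fun i _ => Submodule.sum_mem _ fun j _ => ?_
  rw [Matrix.smul_mul, Matrix.mul_smul]
  exact Submodule.smul_mem _ _ (Submodule.smul_mem _ _
    ((isCommAssocScheme_iff.1 hR).2.2.2.1 _ ⟨i, rfl⟩ _ ⟨j, rfl⟩))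

theorem one_mem_boseMesner (hR : IsCommAssocScheme R) : 1 ∈ boseMesner R :=
  Submodule.subset_span hR.exists_one

theorem boseMesner_conjTranspose (hR : IsCommAssocScheme R) {A : Matrix X X ℂ}
    (hA : A ∈ boseMesner R) : Aᴴ ∈ boseMesner R := by
  classical
  obtain ⟨c, rfl⟩ := (Submodule.mem_span_range_iff_exists_fun ℂ).1 hA
  rw [Matrix.conjTranspose_sum]
  refine Submodule.sum_mem _ fun i _ => ?_
  rw [Matrix.conjTranspose_smul]
  refine Submodule.smul_mem _ _ (Submodule.subset_span ?_)
  obtain ⟨j, hj⟩ := hR.exists_transpose i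
  refine ⟨j, hj.symm.trans ?_⟩
  ext x y
  simp [adjMat_apply, apply_ite]

open scoped ComplexOrder in
-- The algebra is commutative and closed under adjoints, so `A` is normal and `(A Aᴴ)(A Aᴴ)ᴴ = A²
-- (Aᴴ)² = 0`; positivity is then used twice.
theorem eq_zero_of_mul_self_eq_zero (hR : IsCommAssocScheme R) {A : Matrix X X ℂ}
    (hA : A ∈ boseMesner R) (h : A * A = 0) : A = 0 := by
  have hH := hR.boseMesner_comm hA (hR.boseMesner_conjTranspose hA)
  refine Matrix.self_mul_conjTranspose_eq_zero.1 (Matrix.self_mul_conjTranspose_eq_zero.1 ?_)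
  rw [Matrix.conjTranspose_mul, Matrix.conjTranspose_conjTranspose, Matrix.mul_assoc,
    ← Matrix.mul_assoc Aᴴ, ← hH, Matrix.mul_assoc A, ← Matrix.mul_assoc A A, h, Matrix.zero_mul]

theorem linearIndependent_adjMat (hR : IsCommAssocScheme R) :
    LinearIndependent ℂ (adjMat R) := by
  classical
  rw [Fintype.linearIndependent_iff]
  intro c hc i
  obtain ⟨⟨x, y⟩, rfl⟩ := hR.surjective i
  have := congrFun (congrFun hc x) y
  simpa [Matrix.sum_apply, adjMat_apply] using this

theorem exists_isIdempotentBasis (hR : IsCommAssocScheme R) :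
    ∃ E : I → Matrix X X ℂ, IsIdempotentBasis R E := by
  classical
  let B : Subalgebra ℂ (Matrix X X ℂ) := (boseMesner R).toSubalgebra hR.one_mem_boseMesner
    fun _ _ => hR.boseMesner_mul
  have hB : ∀ x : B, (x : Matrix X X ℂ) ∈ boseMesner R := fun x => x.2
  obtain ⟨ι, _, _, b, hb⟩ := exists_basis_orthogonal_idempotents_of_comm (A := B)
    (fun x y => Subtype.ext (hR.boseMesner_comm (hB x) (hB y)))
    (fun x hx => Subtype.ext (hR.eq_zero_of_mul_self_eq_zero (hB x) (congrArg Subtype.val hx)))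
  have hcard : Fintype.card I = Fintype.card ι := by
    rw [← finrank_span_eq_card hR.linearIndependent_adjMat, ← Module.finrank_eq_card_basis b]
    rfl
  let e : I ≃ ι := Fintype.equivOfCardEq hcard
  refine ⟨fun i => b (e i), fun i h => b.ne_zero (e i) (Subtype.ext h), fun i => ?_,
    fun i j hij => ?_, ?_⟩
  · simpa using congrArg Subtype.val (hb (e i) (e i))
  · simpa [hij] using congrArg Subtype.val (hb (e i) (e j))
  · have h1 : Set.range (fun i => ((b (e i) : B) : Matrix X X ℂ)) =
        B.val.toLinearMap '' Set.range b := by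
      rw [← Set.range_comp, ← e.surjective.range_comp]
      rfl
    rw [h1, ← Submodule.map_span, b.span_eq, Submodule.map_top]
    ext M
    constructor
    · rintro ⟨x, rfl⟩
      exact hB x
    · exact fun hM => ⟨⟨M, hM⟩, rfl⟩

/-- Commuting with the all-ones matrix makes every column sum equal to every row sum. -/
theorem exists_ones_mul (hR : IsCommAssocScheme R) {A : Matrix X X ℂ} (hA : A ∈ boseMesner R) :
    ∃ c : ℂ, (Matrix.of fun _ _ => 1) * A = c • (Matrix.of fun _ _ => 1 : Matrix X X ℂ) := by
  have h := hR.boseMesner_comm (ones_mem_boseMesner R) hA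
  have h' : ∀ x y, ∑ z, A z y = ∑ z, A x z := by
    intro x y
    simpa [Matrix.mul_apply] using congrFun (congrFun h x) y
  rcases isEmpty_or_nonempty X with hX | ⟨⟨x₀⟩⟩
  · exact ⟨0, Subsingleton.elim _ _⟩
  · refine ⟨∑ z, A x₀ z, ?_⟩
    ext x y
    simpa [Matrix.mul_apply] using h' x₀ y

/-- The primitive idempotents of a scheme can be labelled such that any given label belongs to
the all-ones matrix, suitably scaled. -/
theorem exists_isIdempotentBasis_ones [DecidableEq I] (hR : IsCommAssocScheme R) (i₀ : I) :
    ∃ E : I → Matrix X X ℂ, IsIdempotentBasis R E ∧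
      (Fintype.card X : ℂ) • E i₀ = Matrix.of fun _ _ => 1 := by
  obtain ⟨E, hE⟩ := hR.exists_isIdempotentBasis
  obtain ⟨⟨x₀, -⟩, -⟩ := hR.surjective i₀
  have : Nonempty X := ⟨x₀⟩
  set J : Matrix X X ℂ := Matrix.of fun _ _ => 1 with hJ
  have hJ0 : J ≠ 0 := fun h => by simpa [hJ] using congrFun (congrFun h x₀) x₀
  have hJJ : J * J = (Fintype.card X : ℂ) • J := by
    ext x y
    simp [hJ, Matrix.mul_apply]
  -- For some `i` the product `J * E i` is a nonzero multiple of `E i`, and it is also a multiple of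
  -- `J`; hence `J = k • E i`, and `J * J = |X| • J` gives `k = |X|`.
  obtain ⟨c, hc, hne⟩ := hE.exists_mul_eq_smul (ones_mem_boseMesner R)
  obtain ⟨i, hi⟩ := hne hJ0
  obtain ⟨d, hd⟩ := hR.exists_ones_mul (A := E i) (hE.span_eq ▸ Submodule.subset_span ⟨i, rfl⟩)
  have hEi : c i • E i = d • J := (hc i).symm.trans hd
  have hd0 : d ≠ 0 := by
    rintro rfl
    rw [zero_smul] at hEi
    exact (smul_ne_zero hi (hE.ne_zero i)) hEi
  have hJi : J = (d⁻¹ * c i) • E i := by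
    rw [mul_smul, hEi, smul_smul, inv_mul_cancel₀ hd0, one_smul]
  set k := d⁻¹ * c i with hk
  have hk0 : k ≠ 0 := mul_ne_zero (inv_ne_zero hd0) hi
  have hkc : k = Fintype.card X := by
    rw [hJi, Matrix.smul_mul, Matrix.mul_smul, hE.idem, smul_comm] at hJJ
    exact smul_left_injective ℂ (smul_ne_zero hk0 (hE.ne_zero i)) hJJ
  refine ⟨E ∘ Equiv.swap i₀ i, ⟨fun j => hE.ne_zero _, fun j => hE.idem _,
    fun j j' hj => hE.orthogonal _ _ ((Equiv.injective _).ne hj), ?_⟩, ?_⟩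
  · rw [(Equiv.surjective _).range_comp, hE.span_eq]
  · rw [Function.comp_apply, Equiv.swap_apply_left, ← hkc, ← hJi]

end IsCommAssocScheme

end BoseMesner

/-! ### Idempotents of the extension and the `Q`-polynomial property -/

section Extension

variable {X : Type*} {ℓ n : ℕ} {R : X → X → Fin (ℓ + 1)}

theorem tensorPow_ne_zero {A : Fin n → Matrix X X ℂ} (hA : ∀ t, A t ≠ 0) :
    tensorPow X n A ≠ 0 := by
  have h : ∀ t, ∃ x y, A t x y ≠ 0 := by
    intro t
    by_contra! h
    exact hA t (Matrix.ext h)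
  choose x y hxy using h
  intro h0
  have : ∏ t, A t (x t) (y t) = 0 := congrFun (congrFun h0 x) y
  exact Finset.prod_ne_zero_iff.2 (fun t _ => hxy t) this

theorem span_symSum_eq_boseMesner {E : Fin (ℓ + 1) → Matrix X X ℂ}
    (hE : Submodule.span ℂ (Set.range E) = boseMesner R) :
    Submodule.span ℂ (Set.range (symSum (tensorPow X n) E)) =
      boseMesner (extensionScheme R n) := by
  rw [boseMesner_extensionScheme]
  apply le_antisymm <;> rw [Submodule.span_le] <;> rintro _ ⟨α, rfl⟩ <;>
    refine symSum_mem_span_symSum _ _ _ (fun i => ?_) α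
  · exact hE.le (Submodule.subset_span ⟨i, rfl⟩)
  · exact hE.ge (Submodule.subset_span ⟨i, rfl⟩)

variable [Fintype X]

namespace IsIdempotentBasis

variable {E : Fin (ℓ + 1) → Matrix X X ℂ}

/-- Tensors of distinct words are orthogonal, since some position carries two different idempotents.
-/
theorem tensorPow_mul_symSum (h : IsIdempotentBasis R E) (f : Fin n → Fin (ℓ + 1))
    (α : Fin ℓ →₀ ℕ) : tensorPow X n (fun t => E (f t)) * symSum (tensorPow X n) E α =
      if wordType f = α then tensorPow X n (fun t => E (f t)) else 0 := by
  have hne : ∀ g, f ≠ g → tensorPow X n (fun t => E (f t) * E (g t)) = 0 := by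
    intro g hg
    obtain ⟨t, ht⟩ := Function.ne_iff.1 hg
    exact MultilinearMap.map_coord_zero _ t (h.orthogonal _ _ ht)
  rw [symSum, Finset.mul_sum]
  simp only [tensorPow_mul]
  rw [Finset.sum_filter, Finset.sum_eq_single f]
  · simp only [h.idem]
  · intro g _ hg
    rw [hne g (Ne.symm hg), ite_self]
  · simp

theorem extension (h : IsIdempotentBasis R E) :
    IsIdempotentBasis (extensionScheme R n)
      fun α : simplexDomain ℓ n => symSum (tensorPow X n) E α := by
  refine ⟨fun α h0 => ?_, fun α => ?_, fun α β hαβ => ?_, ?_⟩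
  · obtain ⟨f, hf⟩ := exists_wordType_eq α.1 (mem_simplexDomain.1 α.2)
    have := h.tensorPow_mul_symSum f α
    rw [h0, Matrix.mul_zero, if_pos hf] at this
    exact tensorPow_ne_zero (fun t => h.ne_zero (f t)) this.symm
  · rw [symSum, Finset.sum_mul]
    refine Finset.sum_congr rfl fun f hf => ?_
    exact (h.tensorPow_mul_symSum f α).trans (if_pos (Finset.mem_filter.1 hf).2)
  · rw [symSum, Finset.sum_mul]
    refine Finset.sum_eq_zero fun f hf => (h.tensorPow_mul_symSum f β).trans (if_neg ?_)
    rw [(Finset.mem_filter.1 hf).2]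
    exact Subtype.coe_ne_coe.2 hαβ
  · rw [← span_symSum_eq_boseMesner h.span_eq, span_range_symSum, setOf_degree_le,
      Set.image_eq_range]

end IsIdempotentBasis

theorem hadMonomial_smul {Y : Type*} (M : Fin ℓ → Matrix Y Y ℂ) (c : ℂ) (β : Fin ℓ →₀ ℕ) :
    hadMonomial (fun i => c • M i) β = c ^ β.degree • hadMonomial M β := by
  ext x y
  simp [hadMonomial, mul_pow, Finset.prod_mul_distrib, Finset.prod_pow_eq_pow_sum,
    Finsupp.degree_eq_sum]

theorem IsCommAssocScheme.extension_isQPolynomial [DecidableEq X] (hn : 1 ≤ n)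
    (hR : IsCommAssocScheme R) (h0 : adjMat R 0 = 1) :
    IsQPolynomial MonomialOrder.degLex (simplexDomain ℓ n) (extensionScheme R n) := by
  obtain ⟨E, hE, hE0⟩ := hR.exists_isIdempotentBasis_ones 0
  have hext := hR.extension (n := n) h0
  obtain ⟨⟨x₀, -⟩, -⟩ := hR.surjective 0
  have : Nonempty X := ⟨x₀⟩
  -- This scaling makes `F 0` the Hadamard unit, as the recursion requires, and matches the factor
  -- `N = |X|^n` in the definition of `Q`-polynomial.
  set F : Fin (ℓ + 1) → Matrix X X ℂ := fun i => (Fintype.card X : ℂ) • E i with hF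
  set N : ℂ := (Fintype.card (Fin n → X) : ℂ) with hN
  have hN0 : N ≠ 0 := by simp [hN]
  set S := symSum (tensorPow X n) E with hS
  set SF := symSum (tensorPow X n) F with hSF
  have hSS : ∀ α, SF α = N • S α := by
    intro α
    rw [hSF, hF, symSum_smul, hN]
    simp [hS]
  have hspanF : Submodule.span ℂ (Set.range F) = boseMesner R := by
    rw [← hE.span_eq]
    apply le_antisymm <;> rw [Submodule.span_le] <;> rintro _ ⟨i, rfl⟩
    · exact Submodule.smul_mem _ _ (Submodule.subset_span ⟨i, rfl⟩)
    · have : E i = (Fintype.card X : ℂ)⁻¹ • F i := by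
        rw [hF, smul_smul, inv_mul_cancel₀ (by simp), one_smul]
      rw [this]
      exact Submodule.smul_mem _ _ (Submodule.subset_span ⟨i, rfl⟩)
  have hFmem : ∀ i, F i ∈ boseMesner R := fun i => hspanF.le (Submodule.subset_span ⟨i, rfl⟩)
  have hFF : ∀ i j, hadamardBilin X (F i) (F j) ∈ Submodule.span ℂ (Set.range F) := fun i j =>
    hspanF.ge (boseMesner_hadamard (hFmem i) (hFmem j))
  set mon := hadMonomial fun i => SF (unitExp i) with hmon
  have hz : mon 0 = SF 0 := by
    rw [hmon, hSF, symSum_zero, show F 0 = Matrix.of fun _ _ => 1 from hE0]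
    ext x y
    simp [hadMonomial, tensorPow_apply]
  have hm : ∀ i β, hadamardBilin _ (SF (unitExp i)) (mon β) = mon (β + unitExp i) := fun i β =>
    hadamard_hadMonomial (fun i => SF (unitExp i)) i β
  have hlead := exists_leading_monomial hz hm
    (mul_symSum_unitExp (tensorPow X n) (hadamardBilin X) (hadamardBilin _) tensorPow_hadamard
      F hFF (fun j => by ext; simp [hF, hE0]) (fun j => by ext; simp [hF, hE0]))
  -- The second condition involves unscaled idempotents; their monomials differ from `mon` by
  -- nonzero scalars, which do not affect spans.
  have hmonS : ∀ β, mon β = N ^ β.degree • hadMonomial (fun i => S (unitExp i)) β := by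
    intro β
    rw [hmon, ← hadMonomial_smul]
    simp only [hSS]
  have hprim : {M | IsPrimIdem (extensionScheme R n) M} = S '' simplexDomain ℓ n := by
    rw [Set.image_eq_range]
    exact Set.ext fun M => hE.extension.isPrimIdem_iff fun A hA B hB => hext.boseMesner_comm hA hB
  refine ⟨hext, unitExp_mem_simplexDomain hn, simplexDomain_lower, S, ⟨?_, ?_, ?_⟩,
    fun α hα => ?_, fun i α hα => ?_⟩
  · rw [hprim]
    exact Set.mapsTo_image _ _
  · intro α hα β hβ h
    exact congrArg Subtype.val (hE.extension.injective (a₁ := ⟨α, hα⟩) (a₂ := ⟨β, hβ⟩) h)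
  · rw [hprim]
    exact Set.surjOn_image _ _
  · obtain ⟨v, hv, hvS⟩ := exists_polynomial n (mem_simplexDomain.1 hα) (hlead α)
    refine ⟨v, hv, ?_⟩
    rw [← hSS, hvS, hmon]
    simp only [hSS]
    rfl
  · have := mul_mon_mem_span hz hm (mul_symSum_mem_span (tensorPow X n) (hadamardBilin X)
      (hadamardBilin _) tensorPow_hadamard F hFF) (span_range_symSum _ _) hlead i hα
    rw [hm, hmonS] at this
    rw [hadamard_hadMonomial (fun j => S (unitExp j))]
    refine (Submodule.span_le.2 ?_)
      (((Submodule.smul_mem_iff _ (pow_ne_zero _ hN0)).1 this))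
    rintro _ ⟨β, hβ, hle, rfl⟩
    rw [hmonS]
    exact Submodule.smul_mem _ _ (Submodule.subset_span ⟨β, hβ, hle, rfl⟩)

end Extension

theorem mainTheorem1 {X : Type*} [Fintype X] [DecidableEq X] (ℓ n : ℕ) (hn : 1 ≤ n)
    (R : X → X → Fin (ℓ + 1)) (hR : IsCommAssocScheme R) :
    IsPPolynomial MonomialOrder.degLex (simplexDomain ℓ n) (extensionScheme R n) ∧
      IsQPolynomial MonomialOrder.degLex (simplexDomain ℓ n) (extensionScheme R n) := by
  classical
  obtain ⟨i₀, hi₀⟩ := hR.exists_one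
  -- The identity relation may carry any label `i₀`; it is moved to `0`, and the result is
  -- transported back along the equality of the sets of adjacency matrices.
  let σ : Equiv.Perm (Fin (ℓ + 1)) := Equiv.swap i₀ 0
  have hsurj : Function.Surjective (Function.uncurry fun x y => σ (R x y)) :=
    σ.surjective.comp hR.surjective
  have hσ : ∀ x y u v, R x y = R u v ↔ σ (R x y) = σ (R u v) := fun x y u v =>
    σ.injective.eq_iff.symm
  have hR' : IsCommAssocScheme fun x y => σ (R x y) :=
    hR.congr hsurj (range_adjMat_congr hR.surjective hsurj hσ)
  have h0 : adjMat (fun x y => σ (R x y)) 0 = 1 := by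
    rw [← hi₀]
    ext x y
    rw [adjMat_apply, adjMat_apply]
    exact if_congr (by rw [← σ.injective.eq_iff (b := i₀), Equiv.swap_apply_left]) rfl rfl
  have hext := extensionScheme_surjective (n := n) hR.surjective
  have hrange := range_adjMat_extension_relabel (n := n) hR.surjective σ
  exact ⟨(hR'.extension_isPPolynomial hn h0).congr hext hrange,
    (hR'.extension_isQPolynomial hn h0).congr hext hrange⟩
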